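/- Let $\mathcal H$ be a nonzero separable complex Hilbert space and let $H$ be a positive, densely defined and possibly unbounded, self-adjoint operator on $\mathcal H$. A state is a positive trace-class operator $\rho$ on $\mathcal H$ with $\operatorname{Tr}\rho=1$; its von Neumann entropy is $S(\rho)=\operatorname{Tr}\eta(\rho)\in[0,+\infty]$, where $\eta(x)=-x\log x$ and $\eta(0)=0$, and its mean energy is $\operatorname{Tr}H\rho=\sup_n\operatorname{Tr}P_nH\rho\in[0,+\infty]$, where $P_n$ is the spectral projector of $H$ corresponding to the interval $[0,n]$. For $E\ge E_0=\inf_{\varphi\in D(H),\,\|\varphi\|=1}\langle\varphi|H|\varphi\rangle$ put $$F_H(E)=\sup\{S(\rho)\;:\;\rho\text{ a state with }\operatorname{Tr}H\rho\le E\}\in[0,+\infty].$$ Then, with $\operatorname{Tr}e^{-\lambda H}\in(0,+\infty]$, $$\lim_{\lambda\to+0}\left[\operatorname{Tr}e^{-\lambda H}\right]^{\lambda}=1\quad\Longleftrightarrow\quad F_H(E)=o(\sqrt E)\ \text{ as } E\to+\infty,$$ where each of the two conditions includes the finiteness of the quantity in it (of $\operatorname{Tr}e^{-\lambda H}$ for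 all sufficiently small $\lambda>0$, and of $F_H(E)$ for all sufficiently large $E$, respectively). -/

import Mathlib

open Filter Topology
open scoped ENNReal

section Trace

variable {E : Type*} [NormedAddCommGroup E] [InnerProductSpace ℂ E] [CompleteSpace E]

/-- The trace, in `[0, ∞]`, of a positive bounded operator `T`, computed in the orthonormal basis
`b`. -/
noncomputable def traceIn {ι : Type*} (b : HilbertBasis ι ℂ E) (T : E →L[ℂ] E) : ℝ≥0∞ :=
  ∑' i, ENNReal.ofReal (inner ℂ (b i) (T (b i))).re

theorem traceIn_star_mul_self {ι κ : Type*} (b : HilbertBasis ι ℂ E) (c : HilbertBasis κ ℂ E)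
    (S : E →L[ℂ] E) : traceIn b (star S * S) = ∑' i, ∑' j, ‖inner ℂ (c j) (S (b i))‖ₑ ^ 2 := by
  unfold traceIn
  congr 1
  funext i
  have h1 : inner ℂ (b i) ((star S * S) (b i)) = inner ℂ (S (b i)) (S (b i)) := by
    rw [_root_.mul_apply_eq_comp, ContinuousLinearMap.star_eq_adjoint,
      ContinuousLinearMap.adjoint_inner_right]
  rw [h1]
  have h2 := (c.hasSum_inner_mul_inner (S (b i)) (S (b i))).mapL Complex.reCLM
  have h3 : ∀ j, Complex.reCLM (inner ℂ (S (b i)) (c j) * inner ℂ (c j) (S (b i)))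
      = ‖inner ℂ (c j) (S (b i))‖ ^ 2 := by
    intro j
    rw [← inner_conj_symm (S (b i)) (c j), Complex.conj_mul']
    simp [← Complex.ofReal_pow]
  simp only [h3] at h2
  have h4 : (inner ℂ (S (b i)) (S (b i))).re = ∑' j, ‖inner ℂ (c j) (S (b i))‖ ^ 2 :=
    h2.tsum_eq.symm
  rw [h4, ENNReal.ofReal_tsum_of_nonneg (fun j => by positivity) h2.summable]
  congr 1
  funext j
  rw [ENNReal.ofReal_pow (norm_nonneg _), ofReal_norm]

/-- The trace of a positive operator does not depend on the basis. -/
theorem traceIn_eq {ι κ : Type*} (b : HilbertBasis ι ℂ E) (c : HilbertBasis κ ℂ E)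
    {T : E →L[ℂ] E} (hT : 0 ≤ T) : traceIn b T = traceIn c T := by
  have hs : star (CFC.sqrt T) = CFC.sqrt T := (CFC.sqrt_nonneg T).isSelfAdjoint
  have hm : star (CFC.sqrt T) * CFC.sqrt T = T := by rw [hs, CFC.sqrt_mul_sqrt_self T hT]
  rw [← hm, traceIn_star_mul_self b c, traceIn_star_mul_self c b, ENNReal.tsum_comm]
  congr 1; funext j; congr 1; funext i
  have h5 : inner ℂ (c j) (CFC.sqrt T (b i)) = inner ℂ (CFC.sqrt T (c j)) (b i) := by
    conv_lhs => rw [← hs, ContinuousLinearMap.star_eq_adjoint,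
      ContinuousLinearMap.adjoint_inner_right]
  rw [h5, ← ofReal_norm, norm_inner_symm, ofReal_norm]

/-- The trace `Tr T ∈ [0, ∞]` of a positive bounded operator `T` (see `traceIn_eq` for the
independence of the basis). -/
noncomputable def opTrace (T : E →L[ℂ] E) : ℝ≥0∞ :=
  traceIn (exists_hilbertBasis ℂ E).choose_spec.choose T

/-- A quantum state: a positive (trace-class) operator of unit trace. -/
def IsState (ρ : E →L[ℂ] E) : Prop := 0 ≤ ρ ∧ opTrace ρ = 1

/-- The von Neumann entropy `Tr η(ρ) ∈ [0, ∞]` of a state `ρ`, where `η(x) = -x log x`. -/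
noncomputable def vonNeumannEntropy (ρ : E →L[ℂ] E) : ℝ≥0∞ := opTrace (cfc Real.negMulLog ρ)

end Trace

/-- A positive, possibly unbounded, (densely defined) self-adjoint operator. -/
structure Hamiltonian (E : Type*) [NormedAddCommGroup E] [InnerProductSpace ℂ E]
    [CompleteSpace E] where
  /-- The underlying partially defined operator. -/
  op : E →ₗ.[ℂ] E
  selfAdjoint : IsSelfAdjoint op
  nonneg : ∀ x : op.domain, 0 ≤ (inner ℂ (x : E) (op x)).re

namespace Hamiltonian

variable {E : Type*} [NormedAddCommGroup E] [InnerProductSpace ℂ E] [CompleteSpace E]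

theorem norm_le (H : Hamiltonian E) (x : H.op.domain) : ‖(x : E)‖ ≤ ‖(x : E) + H.op x‖ := by
  have h1 : ‖(x : E)‖ ^ 2 ≤ ‖(x : E)‖ * ‖(x : E) + H.op x‖ := by
    calc ‖(x : E)‖ ^ 2 ≤ (inner ℂ (x : E) ((x : E) + H.op x)).re := by
          rw [inner_add_right, Complex.add_re, inner_self_eq_norm_sq_to_K]
          have := H.nonneg x
          have h2 : (((‖(x : E)‖ : ℂ)) ^ 2).re = ‖(x : E)‖ ^ 2 := by
            rw [← Complex.ofReal_pow, Complex.ofReal_re]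
          change _ ≤ (((‖(x : E)‖ : ℂ)) ^ 2).re + _
          linarith
      _ ≤ ‖inner ℂ (x : E) ((x : E) + H.op x)‖ := Complex.re_le_norm _
      _ ≤ _ := norm_inner_le_norm _ _
  rcases (norm_nonneg (x : E)).eq_or_lt with h | h
  · rw [← h]; exact norm_nonneg _
  · rw [sq] at h1; exact le_of_mul_le_mul_left h1 h

theorem injective_one_add (H : Hamiltonian E) {x y : H.op.domain}
    (h : (x : E) + H.op x = (y : E) + H.op y) : x = y := by
  have h1 := H.norm_le (x - y)
  have h2 : ((x - y : H.op.domain) : E) + H.op (x - y) = 0 := by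
    rw [LinearPMap.map_sub, Submodule.coe_sub]
    rw [add_comm, ← sub_eq_zero] at h
    rw [← h]; abel
  rw [h2, norm_zero] at h1
  have h3 : ((x - y : H.op.domain) : E) = 0 := norm_le_zero_iff.mp h1
  exact sub_eq_zero.mp (Subtype.ext h3)

/-- `1 + H` as a linear map on the domain of `H`. -/
noncomputable def oneAdd (H : Hamiltonian E) : H.op.domain →ₗ[ℂ] E :=
  H.op.domain.subtype + H.op.toFun

theorem oneAdd_apply (H : Hamiltonian E) (x : H.op.domain) :
    H.oneAdd x = (x : E) + H.op x := rfl

theorem surjective_one_add (H : Hamiltonian E) (y : E) :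
    ∃ x : H.op.domain, (x : E) + H.op x = y := by
  have hclosed : IsClosed (LinearMap.range H.oneAdd : Set E) := by
    rw [← isSeqClosed_iff_isClosed]
    intro u y hu huy
    choose x hx using hu
    have hcau : CauchySeq (fun n => (x n : E)) := by
      rw [Metric.cauchySeq_iff]
      intro ε hε
      obtain ⟨N, hN⟩ := (Metric.cauchySeq_iff.mp huy.cauchySeq) ε hε
      refine ⟨N, fun m hm n hn => lt_of_le_of_lt ?_ (hN m hm n hn)⟩
      rw [dist_eq_norm, dist_eq_norm, ← hx m, ← hx n, ← map_sub, oneAdd_apply]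
      exact H.norm_le (x m - x n)
    obtain ⟨z, hz⟩ := cauchySeq_tendsto_of_complete hcau
    have hH : Tendsto (fun n => H.op (x n)) atTop (𝓝 (y - z)) := by
      refine (huy.sub hz).congr fun n => ?_
      rw [← hx n, oneAdd_apply]; abel
    have hmem : (z, y - z) ∈ H.op.graph := by
      have hc : IsClosed (H.op.graph : Set (E × E)) := H.selfAdjoint.isClosed
      exact hc.mem_of_tendsto (hz.prodMk_nhds hH)
        (Eventually.of_forall fun n => H.op.mem_graph (x n))
    obtain ⟨w, hw1, hw2⟩ := (LinearPMap.mem_graph_iff _).mp hmem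
    refine ⟨w, ?_⟩
    simp only at hw1 hw2
    rw [oneAdd_apply, hw2, hw1]; abel
  have hbot : (LinearMap.range H.oneAdd)ᗮ = ⊥ := by
    rw [Submodule.eq_bot_iff]
    intro z hz
    rw [Submodule.mem_orthogonal'] at hz
    have hdense := H.selfAdjoint.dense_domain
    have hforall : ∀ x : H.op.domain, inner ℂ (-z) (x : E) = inner ℂ z (H.op x) := by
      intro x
      have := hz _ ⟨x, rfl⟩
      rw [oneAdd_apply, inner_add_right] at this
      rw [inner_neg_left]
      exact neg_eq_of_add_eq_zero_right this
    have hsa : H.op.adjoint = H.op := LinearPMap.isSelfAdjoint_def.mp H.selfAdjoint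
    have hz' : z ∈ H.op.adjoint.domain := LinearPMap.mem_adjoint_domain_of_exists z ⟨-z, hforall⟩
    have hval : H.op.adjoint ⟨z, hz'⟩ = -z :=
      LinearPMap.adjoint_apply_eq hdense ⟨z, hz'⟩ hforall
    have hg : (z, -z) ∈ H.op.graph := by
      rw [← hsa]
      exact (LinearPMap.mem_graph_iff _).mpr ⟨⟨z, hz'⟩, rfl, hval⟩
    obtain ⟨w, hw1, hw2⟩ := (LinearPMap.mem_graph_iff _).mp hg
    simp only at hw1 hw2
    have h1 := H.norm_le w
    rw [hw1, hw2, add_neg_cancel, norm_zero] at h1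
    exact norm_le_zero_iff.mp h1
  have htop : LinearMap.range H.oneAdd = ⊤ := by
    have : CompleteSpace (LinearMap.range H.oneAdd) := hclosed.completeSpace_coe
    exact Submodule.orthogonal_eq_bot_iff.mp hbot
  have : y ∈ LinearMap.range H.oneAdd := by rw [htop]; trivial
  obtain ⟨x, hx⟩ := this
  exact ⟨x, hx⟩

theorem bijective_oneAdd (H : Hamiltonian E) : Function.Bijective H.oneAdd :=
  ⟨fun _ _ h => H.injective_one_add h, fun y => H.surjective_one_add y⟩

/-- The resolvent `(1 + H)⁻¹`, as a bounded operator on the whole space. -/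
noncomputable def resolvent (H : Hamiltonian E) : E →L[ℂ] E :=
  (H.op.domain.subtype ∘ₗ
    (LinearEquiv.ofBijective H.oneAdd H.bijective_oneAdd).symm.toLinearMap).mkContinuous 1 (by
      intro y
      obtain ⟨x, rfl⟩ := H.bijective_oneAdd.2 y
      have : (LinearEquiv.ofBijective H.oneAdd H.bijective_oneAdd).symm (H.oneAdd x) = x :=
        LinearEquiv.symm_apply_apply (LinearEquiv.ofBijective H.oneAdd H.bijective_oneAdd) x
      rw [one_mul, LinearMap.comp_apply, LinearEquiv.coe_coe, this]
      exact H.norm_le x)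

theorem resolvent_apply (H : Hamiltonian E) (x : H.op.domain) :
    H.resolvent ((x : E) + H.op x) = x :=
  congrArg Subtype.val
    (LinearEquiv.symm_apply_apply (LinearEquiv.ofBijective H.oneAdd H.bijective_oneAdd) x)

theorem resolvent_mem (H : Hamiltonian E) (y : E) : H.resolvent y ∈ H.op.domain := by
  obtain ⟨x, rfl⟩ := H.surjective_one_add y
  rw [resolvent_apply]; exact x.2

theorem op_resolvent (H : Hamiltonian E) (y : E) :
    H.op ⟨H.resolvent y, H.resolvent_mem y⟩ = y - H.resolvent y := by
  obtain ⟨x, rfl⟩ := H.surjective_one_add y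
  have : (⟨H.resolvent ((x : E) + H.op x), H.resolvent_mem _⟩ : H.op.domain) = x :=
    Subtype.ext (H.resolvent_apply x)
  rw [this, resolvent_apply]; abel

theorem op_symm (H : Hamiltonian E) (x y : H.op.domain) :
    inner ℂ (H.op x) (y : E) = inner ℂ (x : E) (H.op y) := by
  have h := LinearPMap.adjoint_isFormalAdjoint (T := H.op) H.selfAdjoint.dense_domain
  rw [LinearPMap.isSelfAdjoint_def.mp H.selfAdjoint] at h
  exact h x y

open scoped ComplexOrder in
theorem resolvent_nonneg (H : Hamiltonian E) : 0 ≤ H.resolvent := by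
  rw [ContinuousLinearMap.nonneg_iff_isPositive, ContinuousLinearMap.isPositive_iff]
  constructor
  · intro u v
    obtain ⟨x, rfl⟩ := H.surjective_one_add u
    obtain ⟨y, rfl⟩ := H.surjective_one_add v
    simp only [ContinuousLinearMap.coe_coe]
    rw [resolvent_apply, resolvent_apply, inner_add_left, inner_add_right, H.op_symm]
  · intro u
    obtain ⟨x, rfl⟩ := H.surjective_one_add u
    have him : (inner ℂ (x : E) (H.op x)).im = 0 := by
      rw [← Complex.conj_eq_iff_im, inner_conj_symm, H.op_symm]
    rw [resolvent_apply, inner_add_right]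
    exact add_nonneg
      (Complex.nonneg_iff.mpr ⟨inner_self_nonneg (𝕜 := ℂ), (inner_self_im (𝕜 := ℂ) (x : E)).symm⟩)
      (Complex.nonneg_iff.mpr ⟨H.nonneg x, him.symm⟩)

theorem resolvent_isSelfAdjoint (H : Hamiltonian E) : IsSelfAdjoint H.resolvent :=
  H.resolvent_nonneg.isSelfAdjoint

/-- The operator `e^{-tH}`, `t > 0`: since `H = φ(R)` with `R = (1 + H)⁻¹` and `φ(x) = x⁻¹ - 1`,
it is `f(R)` with `f(x) = e^{-t φ(x)}` on `(0, 1]`, continuously extended by `f(0) = 0`. -/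
noncomputable def expNeg (H : Hamiltonian E) (t : ℝ) : E →L[ℂ] E :=
  cfc (fun x : ℝ => if x ≤ 0 then 0 else Real.exp (-t * (x⁻¹ - 1))) H.resolvent

/-- The spectral subspace of `H` for the interval `[0, n]`, i.e. the kernel of the positive part
of `H - n`; in terms of the resolvent `R = (1 + H)⁻¹` it is the kernel of the positive part of
`(1 + n)⁻¹ - R`. -/
noncomputable def spectralSubspace (H : Hamiltonian E) (n : ℕ) : Submodule ℂ E :=
  LinearMap.ker (cfc (fun x : ℝ => max ((1 + (n : ℝ))⁻¹ - x) 0) H.resolvent).toLinearMap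

instance (H : Hamiltonian E) (n : ℕ) : CompleteSpace (H.spectralSubspace n) :=
  (ContinuousLinearMap.isClosed_ker
    (cfc (fun x : ℝ => max ((1 + (n : ℝ))⁻¹ - x) 0) H.resolvent)).completeSpace_coe

/-- The spectral projector `P_n` of `H` for the interval `[0, n]`. -/
noncomputable def spectralProj (H : Hamiltonian E) (n : ℕ) : E →L[ℂ] E :=
  (H.spectralSubspace n).starProjection

theorem resolvent_inv_apply (H : Hamiltonian E) (n : ℕ) {y : E} (hy : y ∈ H.spectralSubspace n) :
    H.resolvent (cfc (fun x : ℝ => (max x (1 + (n : ℝ))⁻¹)⁻¹) H.resolvent y) = y := by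
  have hc : 0 < (1 + (n : ℝ))⁻¹ := by positivity
  set c : ℝ := (1 + (n : ℝ))⁻¹ with hcdef
  set R := H.resolvent with hR
  have hsa : IsSelfAdjoint R := H.resolvent_isSelfAdjoint
  have hcont : Continuous fun x : ℝ => (max x c)⁻¹ :=
    (continuous_id.max continuous_const).inv₀ fun x => (lt_max_of_lt_right hc).ne'
  have h1 : R * cfc (fun x : ℝ => (max x c)⁻¹) R
      = 1 - c⁻¹ • cfc (fun x : ℝ => max (c - x) 0) R := by
    conv_lhs => enter [1]; rw [← cfc_id' ℝ R]
    rw [← cfc_mul (fun x : ℝ => x) _ R (by fun_prop) hcont.continuousOn,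
      ← cfc_smul c⁻¹ (fun x : ℝ => max (c - x) 0) R (by fun_prop), ← cfc_one ℝ R,
      ← cfc_sub _ _ R (by fun_prop) (by fun_prop)]
    refine cfc_congr fun x _ => ?_
    simp only [Pi.one_apply, smul_eq_mul]
    rcases le_total x c with h | h
    · rw [max_eq_right h, max_eq_left (sub_nonneg.mpr h)]
      field_simp
      ring
    · rw [max_eq_left h, max_eq_right (sub_nonpos.mpr h), mul_zero, sub_zero,
        mul_inv_cancel₀ (hc.trans_le h).ne']
  have h2 : cfc (fun x : ℝ => max (c - x) 0) R y = 0 := hy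
  have h3 := congrArg (fun T : E →L[ℂ] E => T y) h1
  simpa [h2] using h3

theorem spectralProj_mem (H : Hamiltonian E) (n : ℕ) (x : E) :
    H.spectralProj n x ∈ H.op.domain := by
  rw [← H.resolvent_inv_apply n (y := H.spectralProj n x)
    (Submodule.starProjection_apply_mem _ _)]
  exact H.resolvent_mem _

theorem op_spectralProj (H : Hamiltonian E) (n : ℕ) (x : E) :
    H.op ⟨H.spectralProj n x, H.spectralProj_mem n x⟩ =
      cfc (fun x : ℝ => (max x (1 + (n : ℝ))⁻¹)⁻¹) H.resolvent (H.spectralProj n x)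
        - H.spectralProj n x := by
  have hy : H.spectralProj n x ∈ H.spectralSubspace n := Submodule.starProjection_apply_mem _ _
  generalize_proofs hmem
  revert hmem
  generalize H.spectralProj n x = y at hy
  intro hmem
  have h := H.op_resolvent (cfc (fun x : ℝ => (max x (1 + (n : ℝ))⁻¹)⁻¹) H.resolvent y)
  simp only [H.resolvent_inv_apply n hy] at h
  exact h

/-- The bounded operator `P_n H = H P_n`. -/
noncomputable def truncation (H : Hamiltonian E) (n : ℕ) : E →L[ℂ] E where
  toFun x := H.op ⟨H.spectralProj n x, H.spectralProj_mem n x⟩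
  map_add' x y := by
    rw [op_spectralProj, op_spectralProj, op_spectralProj, map_add, map_add]; abel
  map_smul' a x := by
    rw [op_spectralProj, op_spectralProj, map_smul, map_smul, RingHom.id_apply, smul_sub]
  cont := by
    simp only [op_spectralProj]
    fun_prop

/-- The mean energy `Tr Hρ = sup_n Tr P_n H ρ ∈ [0, ∞]` of a state `ρ`, where for a positive
bounded operator `A` the value `Tr Aρ` is written as the trace of the positive operator
`√ρ A √ρ`. -/
noncomputable def energy (H : Hamiltonian E) (ρ : E →L[ℂ] E) : ℝ≥0∞ :=
  ⨆ n : ℕ, opTrace (CFC.sqrt ρ * H.truncation n * CFC.sqrt ρ)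

/-- `F_H(x)`, the supremum in `[0, ∞]` of the von Neumann entropy over all states of mean energy
at most `x`. -/
noncomputable def maxEntropy (H : Hamiltonian E) (x : ℝ) : ℝ≥0∞ :=
  ⨆ (ρ : E →L[ℂ] E) (_ : IsState ρ) (_ : H.energy ρ ≤ ENNReal.ofReal x), vonNeumannEntropy ρ

end Hamiltonian

/-!
The two conditions are tied together by Legendre duality between `log Tr e^{-tH}` and `F_H`,
applied to the pair `δ² / t` and `δ √x`.

Each condition forces every spectral subspace of `H` for `[0, n]` to have finite dimension:
`e^{-tH}` is bounded below there (`Hamiltonian.finiteDimensional_of_opTrace_expNeg`), and `N`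
orthonormal vectors in it carry a uniform state of entropy `log N` and energy at most `2 + n`
(`Hamiltonian.finiteDimensional_of_maxEntropy`). Diagonalizing the resolvent `R = (1 + H)⁻¹` on
these subspaces, and using that `R` is small on their orthogonal complements, one obtains a Hilbert
basis `e` of eigenvectors of `H`, with eigenvalues `ε` (`Hamiltonian.exists_isEigenbasis`). Then
`Tr e^{-tH} = ∑ e^{-t ε i}`.

From left to right, the Gibbs inequality `S(ρ) ≤ t Tr Hρ + log Z`
(`Hamiltonian.IsEigenbasis.vonNeumannEntropy_le`) gives `F_H(x) ≤ t x + δ² / t` for small `t`,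
hence `F_H(x) ≤ 2 δ √x` for large `x` by the choice `t = δ / √x`.

From right to left, the Gibbs states of finite sets of eigenvectors
(`Hamiltonian.IsEigenbasis.opTrace_expNeg_le`) turn `F_H(x) ≤ k √x` into
`log Tr e^{-tH} ≤ sup_m (k √m - t m) + O(1) = k² / (4 t) + O(1)`. For the lower bound on
`(Tr e^{-tH})^t` a single eigenvalue is enough.
-/

/-! ### Continuous functional calculus on vectors -/

section FunctionalCalculus

variable {E : Type*} [NormedAddCommGroup E] [InnerProductSpace ℂ E] [CompleteSpace E]

theorem norm_cfc_apply_sq {T : E →L[ℂ] E} (hT : IsSelfAdjoint T) (f : ℝ → ℝ)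
    (hf : Continuous f) (x : E) :
    ‖cfc f T x‖ ^ 2 = (inner ℂ x (cfc (fun t => f t ^ 2) T x)).re := by
  have h : cfc (fun t => f t ^ 2) T = star (cfc f T) * cfc f T := by
    rw [(cfc_predicate f T : IsSelfAdjoint _).star_eq, ← sq,
      ← cfc_pow f 2 T (hf := hf.continuousOn)]
  rw [h, _root_.mul_apply_eq_comp, ContinuousLinearMap.star_eq_adjoint,
    ContinuousLinearMap.adjoint_inner_right]
  exact (inner_self_eq_norm_sq (𝕜 := ℂ) _).symm

theorem re_inner_mono {S T : E →L[ℂ] E} (h : S ≤ T) (x : E) :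
    (inner ℂ x (S x)).re ≤ (inner ℂ x (T x)).re := by
  have := (ContinuousLinearMap.nonneg_iff_isPositive _ |>.mp
    (sub_nonneg.mpr h)).re_inner_nonneg_right x
  simpa [inner_sub_right] using this

/-- Pointwise comparison of functions on the spectrum compares norms of vectors. -/
theorem norm_cfc_apply_le {T : E →L[ℂ] E} (hT : IsSelfAdjoint T) {f g : ℝ → ℝ}
    (hf : Continuous f) (hg : Continuous g) (h : ∀ t ∈ spectrum ℝ T, |f t| ≤ |g t|) (x : E) :
    ‖cfc f T x‖ ≤ ‖cfc g T x‖ := by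
  rw [← sq_le_sq₀ (norm_nonneg _) (norm_nonneg _), norm_cfc_apply_sq hT f hf,
    norm_cfc_apply_sq hT g hg]
  refine re_inner_mono (cfc_mono (fun t ht => sq_le_sq.mpr (h t ht)) ?_ ?_) x <;> fun_prop

theorem aeval_apply_of_apply_eq_smul {F : Type*} [NormedAddCommGroup F] [InnerProductSpace ℂ F]
    {T : F →L[ℂ] F} {r : ℝ} {x : F} (hx : T x = (r : ℂ) • x) (p : Polynomial ℝ) :
    Polynomial.aeval T p x = ((p.eval r : ℝ) : ℂ) • x := by
  induction p using Polynomial.induction_on with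
  | C a => simp [Algebra.algebraMap_eq_smul_one]
  | add p q hp hq => simp [hp, hq, add_smul]
  | monomial n a h =>
    have : Polynomial.aeval T (Polynomial.C a * Polynomial.X ^ (n + 1)) x
        = Polynomial.aeval T (Polynomial.C a * Polynomial.X ^ n) (T x) := by
      simp only [map_mul, map_pow, Polynomial.aeval_X, Polynomial.aeval_C, pow_succ,
        _root_.mul_apply_eq_comp]
    rw [this, hx, map_smul, h, smul_smul]
    congr 1
    simp
    ring

/-- The continuous functional calculus acts on eigenvectors through the eigenvalue. -/
theorem cfc_apply_of_apply_eq_smul {T : E →L[ℂ] E} (hT : IsSelfAdjoint T) {f : ℝ → ℝ}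
    (hf : Continuous f) {r : ℝ} {x : E} (hx : T x = (r : ℂ) • x) :
    cfc f T x = (f r : ℂ) • x := by
  rw [← sub_eq_zero, ← norm_le_zero_iff]
  refine le_of_forall_pos_le_add fun ε hε => ?_
  obtain ⟨δ, hδ, hδε⟩ : ∃ δ : ℝ, 0 < δ ∧ 2 * δ * ‖x‖ ≤ ε := by
    refine ⟨ε / (2 * (‖x‖ + 1)), by positivity, ?_⟩
    have : 2 * (ε / (2 * (‖x‖ + 1))) * ‖x‖ = ε * (‖x‖ / (‖x‖ + 1)) := by field_simp
    rw [this]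
    exact mul_le_of_le_one_right hε.le (div_le_one_of_le₀ (by linarith) (by positivity))
  -- `f` is approximated by a polynomial on an interval that contains the spectrum and `r`
  set M : ℝ := max (‖T‖ * ‖(1 : E →L[ℂ] E)‖) |r|
  obtain ⟨p, hp⟩ := exists_polynomial_near_of_continuousOn (-M) M f hf.continuousOn δ hδ
  have h1 : ‖cfc (fun t => f t - p.eval t) T x‖ ≤ δ * ‖x‖ := by
    have := norm_cfc_apply_le hT (f := fun t => f t - p.eval t) (g := fun _ => δ)
      (by fun_prop) (by fun_prop) (fun t ht => ?_) x
    · rwa [cfc_const δ T, Algebra.algebraMap_eq_smul_one, smul_apply,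
        one_apply_eq_self, norm_smul, Real.norm_of_nonneg hδ.le] at this
    · rw [abs_sub_comm, abs_of_pos hδ]
      refine (hp t ?_).le
      rw [Set.mem_Icc, ← abs_le]
      exact (spectrum.norm_le_norm_mul_of_mem ht).trans (le_max_left _ _)
  have h2 : cfc (fun t => f t - p.eval t) T x = cfc f T x - ((p.eval r : ℝ) : ℂ) • x := by
    rw [cfc_sub f (fun t => p.eval t) T (by fun_prop) (by fun_prop), cfc_polynomial p T,
      sub_apply, aeval_apply_of_apply_eq_smul hx]
  have h3 : ‖(((p.eval r : ℝ) : ℂ) - (f r : ℂ)) • x‖ ≤ δ * ‖x‖ := by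
    rw [norm_smul, ← Complex.ofReal_sub, Complex.norm_real, Real.norm_eq_abs]
    gcongr
    exact (hp r (by rw [Set.mem_Icc, ← abs_le]; exact le_max_right _ _)).le
  calc ‖cfc f T x - (f r : ℂ) • x‖
      = ‖(cfc f T x - ((p.eval r : ℝ) : ℂ) • x) + (((p.eval r : ℝ) : ℂ) - (f r : ℂ)) • x‖ := by
        rw [sub_smul]; congr 1; abel
    _ ≤ δ * ‖x‖ + δ * ‖x‖ := (norm_add_le _ _).trans (add_le_add (h2 ▸ h1) h3)
    _ ≤ 0 + ε := by linarith

theorem sqrt_apply_of_apply_eq_smul {T : E →L[ℂ] E} (hT : 0 ≤ T) {r : ℝ} {x : E}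
    (hx : T x = (r : ℂ) • x) : CFC.sqrt T x = (√r : ℂ) • x := by
  rw [CFC.sqrt_eq_real_sqrt T hT, cfcₙ_eq_cfc (hf := by fun_prop) (hf0 := by simp)]
  exact cfc_apply_of_apply_eq_smul hT.isSelfAdjoint Real.continuous_sqrt hx

theorem nonneg_of_re_inner_nonneg {T : E →L[ℂ] E} (hT : IsSelfAdjoint T)
    (h : ∀ x, 0 ≤ (inner ℂ x (T x)).re) : 0 ≤ T := by
  rw [ContinuousLinearMap.nonneg_iff_isPositive, ContinuousLinearMap.isPositive_def']
  refine ⟨hT, fun x => ?_⟩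
  rw [ContinuousLinearMap.reApplyInnerSelf_apply, inner_re_symm]
  exact h x

theorem inner_sqrt_left {T : E →L[ℂ] E} (x y : E) :
    inner ℂ (CFC.sqrt T x) y = inner ℂ x (CFC.sqrt T y) := by
  have hs : star (CFC.sqrt T) = CFC.sqrt T := (CFC.sqrt_nonneg T).isSelfAdjoint
  conv_lhs => rw [← hs, ContinuousLinearMap.star_eq_adjoint,
      ContinuousLinearMap.adjoint_inner_left]

theorem re_inner_eq_norm_sqrt_sq {T : E →L[ℂ] E} (hT : 0 ≤ T) (x : E) :
    (inner ℂ x (T x)).re = ‖CFC.sqrt T x‖ ^ 2 := by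
  rw [← CFC.sqrt_mul_sqrt_self T hT, _root_.mul_apply_eq_comp, ← inner_sqrt_left,
    CFC.sqrt_mul_sqrt_self T hT]
  exact inner_self_eq_norm_sq (𝕜 := ℂ) _

theorem isSelfAdjoint_inner_left {T : E →L[ℂ] E} (hT : IsSelfAdjoint T) (x y : E) :
    inner ℂ (T x) y = inner ℂ x (T y) := by
  conv_lhs => rw [← hT.star_eq, ContinuousLinearMap.star_eq_adjoint,
      ContinuousLinearMap.adjoint_inner_left]

end FunctionalCalculus

/-! ### Traces and states -/

section Trace

variable {E : Type*} [NormedAddCommGroup E] [InnerProductSpace ℂ E] [CompleteSpace E]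

theorem opTrace_eq_traceIn {ι : Type*} (b : HilbertBasis ι ℂ E) {T : E →L[ℂ] E} (hT : 0 ≤ T) :
    opTrace T = traceIn b T :=
  traceIn_eq _ b hT

/-- Parseval's identity, in `[0, ∞]`. -/
theorem tsum_enorm_inner_sq {F : Type*} [NormedAddCommGroup F] [InnerProductSpace ℂ F]
    {ι : Type*} (b : HilbertBasis ι ℂ F) (x : F) :
    ∑' i, ‖inner ℂ (b i) x‖ₑ ^ 2 = ‖x‖ₑ ^ 2 := by
  have h2 := (b.hasSum_inner_mul_inner x x).mapL Complex.reCLM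
  have h3 : ∀ j, Complex.reCLM (inner ℂ x (b j) * inner ℂ (b j) x)
      = ‖inner ℂ (b j) x‖ ^ 2 := by
    intro j
    rw [← inner_conj_symm x (b j), Complex.conj_mul']
    simp [← Complex.ofReal_pow]
  simp only [h3] at h2
  have h4 : Complex.reCLM (inner ℂ x x) = ‖x‖ ^ 2 := inner_self_eq_norm_sq (𝕜 := ℂ) x
  rw [h4] at h2
  rw [← ofReal_norm x, ← ENNReal.ofReal_pow (norm_nonneg _), ← h2.tsum_eq,
    ENNReal.ofReal_tsum_of_nonneg (fun j => by positivity) h2.summable]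
  simp_rw [ENNReal.ofReal_pow (norm_nonneg _), ofReal_norm]

theorem ofReal_re_inner_eq_enorm_sqrt_sq {T : E →L[ℂ] E} (hT : 0 ≤ T) (x : E) :
    ENNReal.ofReal (inner ℂ x (T x)).re = ‖CFC.sqrt T x‖ₑ ^ 2 := by
  rw [re_inner_eq_norm_sqrt_sq hT, ENNReal.ofReal_pow (norm_nonneg _), ofReal_norm]

/-- A positive operator is bounded by its trace. -/
theorem ofReal_re_inner_le_opTrace {T : E →L[ℂ] E} (hT : 0 ≤ T) (x : E) :
    ENNReal.ofReal (inner ℂ x (T x)).re ≤ opTrace T * ‖x‖ₑ ^ 2 := by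
  obtain ⟨w, b, -⟩ := exists_hilbertBasis ℂ E
  rw [opTrace_eq_traceIn b hT, ofReal_re_inner_eq_enorm_sqrt_sq hT, ← tsum_enorm_inner_sq b,
    traceIn, ← ENNReal.tsum_mul_right]
  refine ENNReal.tsum_le_tsum fun i => ?_
  rw [ofReal_re_inner_eq_enorm_sqrt_sq hT, ← inner_sqrt_left, ← mul_pow, ← ofReal_norm,
    ← ofReal_norm, ← ofReal_norm, ← ENNReal.ofReal_mul (norm_nonneg _)]
  gcongr
  exact norm_inner_le_norm _ _

/-- So the spectrum of a state lies in `[0, 1]`, where `η ≥ 0`. -/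
theorem IsState.le_one {ρ : E →L[ℂ] E} (h : IsState ρ) : ρ ≤ 1 := by
  rw [← sub_nonneg]
  refine nonneg_of_re_inner_nonneg ((IsSelfAdjoint.one _).sub h.1.isSelfAdjoint) fun x => ?_
  have h1 := ofReal_re_inner_le_opTrace h.1 x
  rw [h.2, one_mul, ← ofReal_norm, ← ENNReal.ofReal_pow (norm_nonneg _),
    ENNReal.ofReal_le_ofReal_iff (by positivity)] at h1
  have h2 : (inner ℂ x x).re = ‖x‖ ^ 2 := inner_self_eq_norm_sq (𝕜 := ℂ) x
  rw [sub_apply, one_apply_eq_self, inner_sub_right, Complex.sub_re, h2]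
  linarith

theorem IsState.spectrum_subset {ρ : E →L[ℂ] E} (h : IsState ρ) :
    spectrum ℝ ρ ⊆ Set.Icc 0 1 := fun t ht =>
  ⟨spectrum_nonneg_of_nonneg h.1 ht, (le_algebraMap_iff_spectrum_le (r := (1 : ℝ)) (a := ρ)
    (ha := h.1.isSelfAdjoint)).mp (by simpa using h.le_one) t ht⟩

theorem IsState.negMulLog_nonneg {ρ : E →L[ℂ] E} (h : IsState ρ) :
    0 ≤ cfc Real.negMulLog ρ :=
  cfc_nonneg fun _ ht =>
    Real.negMulLog_nonneg (h.spectrum_subset ht).1 (h.spectrum_subset ht).2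

end Trace

/-! ### Spectral subspaces, truncations and the eigenbasis -/

section Dimension

variable {E : Type*} [NormedAddCommGroup E] [InnerProductSpace ℂ E] [CompleteSpace E]

/-- A closed subspace has finite dimension as soon as there is a uniform bound on the number of
members of a Hilbert basis of the whole space that it can contain. -/
theorem finiteDimensional_of_forall_hilbertBasis (V : Submodule ℂ E) [CompleteSpace V] (C : ℕ)
    (h : ∀ (w : Set E) (b : HilbertBasis w ℂ E) (s : Finset w), (∀ i ∈ s, b i ∈ V) → s.card ≤ C) :
    FiniteDimensional ℂ V := by
  obtain ⟨u, c, hc⟩ := exists_hilbertBasis ℂ V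
  have hu : u.Finite := by
    by_contra hinf
    have : Infinite u := Set.infinite_coe_iff.mpr hinf
    obtain ⟨t, ht⟩ := Infinite.exists_subset_card_eq u (C + 1)
    have horth : Orthonormal ℂ ((↑) : Set.range (fun i : u => (c i : E)) → E) :=
      (c.orthonormal.comp_linearIsometry V.subtypeₗᵢ).toSubtypeRange
    obtain ⟨w, b, hw, hb⟩ := horth.exists_hilbertBasis_extension
    have hmem : ∀ i : u, (c i : E) ∈ w := fun i => hw ⟨i, rfl⟩
    have hinj : Function.Injective fun i : u => (⟨(c i : E), hmem i⟩ : w) := fun i j hij =>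
      c.orthonormal.linearIndependent.injective
        (Subtype.ext (congrArg (fun z : w => (z : E)) hij))
    have := h w b (t.map ⟨_, hinj⟩) (by
      intro i hi
      obtain ⟨j, -, rfl⟩ := Finset.mem_map.mp hi
      rw [hb]
      exact (c j).2)
    rw [Finset.card_map, ht] at this
    omega
  have := hu.fintype
  exact FiniteDimensional.of_finite_basis c.toOrthonormalBasis.toBasis u.toFinite

end Dimension

namespace Hamiltonian

variable {E : Type*} [NormedAddCommGroup E] [InnerProductSpace ℂ E] [CompleteSpace E]

theorem resolvent_eq_zero (H : Hamiltonian E) {y : E} (hy : H.resolvent y = 0) : y = 0 := by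
  obtain ⟨x, rfl⟩ := H.surjective_one_add y
  rw [resolvent_apply] at hy
  have : x = 0 := Subtype.ext hy
  simp [this]

theorem norm_resolvent_apply_le (H : Hamiltonian E) (y : E) : ‖H.resolvent y‖ ≤ ‖y‖ := by
  obtain ⟨x, rfl⟩ := H.surjective_one_add y
  rw [resolvent_apply]
  exact H.norm_le x

theorem spectrum_resolvent_nonneg (H : Hamiltonian E) {t : ℝ} (ht : t ∈ spectrum ℝ H.resolvent) :
    0 ≤ t :=
  spectrum_nonneg_of_nonneg H.resolvent_nonneg ht

theorem mem_spectralSubspace (H : Hamiltonian E) (n : ℕ) (x : E) :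
    x ∈ H.spectralSubspace n ↔
      cfc (fun x : ℝ => max ((1 + (n : ℝ))⁻¹ - x) 0) H.resolvent x = 0 := Iff.rfl

theorem spectralSubspace_mono (H : Hamiltonian E) {m n : ℕ} (hmn : m ≤ n) :
    H.spectralSubspace m ≤ H.spectralSubspace n := by
  intro x hx
  rw [mem_spectralSubspace] at hx ⊢
  refine norm_le_zero_iff.mp (le_of_le_of_eq (norm_cfc_apply_le H.resolvent_isSelfAdjoint
    (g := fun x : ℝ => max ((1 + (m : ℝ))⁻¹ - x) 0) (by fun_prop) (by fun_prop)
    (fun t _ => ?_) x) (by rw [hx, norm_zero]))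
  rw [abs_of_nonneg (le_max_right _ _), abs_of_nonneg (le_max_right _ _)]
  gcongr

theorem cfc_mem_spectralSubspace (H : Hamiltonian E) {n : ℕ} (f : ℝ → ℝ) {x : E}
    (hx : x ∈ H.spectralSubspace n) : cfc f H.resolvent x ∈ H.spectralSubspace n := by
  rw [mem_spectralSubspace] at hx ⊢
  have h := cfc_commute_cfc (fun x : ℝ => max ((1 + (n : ℝ))⁻¹ - x) 0) f H.resolvent
  rw [← _root_.mul_apply_eq_comp, h.eq, _root_.mul_apply_eq_comp, hx, map_zero]

theorem resolvent_mem_spectralSubspace (H : Hamiltonian E) {n : ℕ} {x : E}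
    (hx : x ∈ H.spectralSubspace n) : H.resolvent x ∈ H.spectralSubspace n := by
  have := H.cfc_mem_spectralSubspace (fun t => t) hx
  rwa [cfc_id' ℝ H.resolvent H.resolvent_isSelfAdjoint] at this

/-- The resolvent is small off the spectral subspaces, since these are kernels of
`((1 + n)⁻¹ - R)₊`, whose range is dense in the orthogonal complement. -/
theorem norm_resolvent_le_of_mem_orthogonal (H : Hamiltonian E) (n : ℕ) {x : E}
    (hx : x ∈ (H.spectralSubspace n)ᗮ) : ‖H.resolvent x‖ ≤ (1 + (n : ℝ))⁻¹ * ‖x‖ := by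
  set c : ℝ := (1 + (n : ℝ))⁻¹ with hc
  have hc0 : 0 < c := by positivity
  set A := cfc (fun x : ℝ => max (c - x) 0) H.resolvent with hA
  have hAsa : IsSelfAdjoint A := cfc_predicate _ _
  have hx' : x ∈ closure (Set.range A) := by
    have h := ContinuousLinearMap.orthogonal_ker A
    rw [← ContinuousLinearMap.star_eq_adjoint, hAsa.star_eq] at h
    have hx2 : x ∈ (LinearMap.ker A.toLinearMap)ᗮ := hx
    rw [h] at hx2
    exact hx2
  have hclosed : IsClosed {x : E | ‖H.resolvent x‖ ≤ c * ‖x‖} :=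
    isClosed_le (by fun_prop) (by fun_prop)
  refine closure_minimal ?_ hclosed hx'
  rintro _ ⟨y, rfl⟩
  have h1 : H.resolvent (A y) = cfc (fun t : ℝ => t * max (c - t) 0) H.resolvent y := by
    rw [cfc_mul (fun t : ℝ => t) (fun t => max (c - t) 0) H.resolvent (by fun_prop)
      (by fun_prop), cfc_id' ℝ H.resolvent H.resolvent_isSelfAdjoint, _root_.mul_apply_eq_comp]
  have h2 : cfc (fun t : ℝ => c * max (c - t) 0) H.resolvent y = c • A y := by
    rw [cfc_const_mul c _ H.resolvent (by fun_prop), smul_apply]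
  have h3 : c * ‖A y‖ = ‖c • A y‖ := by rw [norm_smul, Real.norm_of_nonneg hc0.le]
  change ‖H.resolvent (A y)‖ ≤ c * ‖A y‖
  rw [h3, h1, ← h2]
  refine norm_cfc_apply_le H.resolvent_isSelfAdjoint (by fun_prop) (by fun_prop)
    (fun t ht => ?_) y
  have ht0 := H.spectrum_resolvent_nonneg ht
  rw [abs_mul, abs_mul, abs_of_nonneg ht0, abs_of_pos hc0]
  rcases le_total t c with h | h
  · gcongr
  · simp [max_eq_right (sub_nonpos.mpr h)]

theorem truncation_apply (H : Hamiltonian E) (n : ℕ) (x : E) :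
    H.truncation n x = H.op ⟨H.spectralProj n x, H.spectralProj_mem n x⟩ := rfl

theorem truncation_apply_eq_cfc (H : Hamiltonian E) (n : ℕ) (x : E) :
    H.truncation n x = cfc (fun x : ℝ => (max x (1 + (n : ℝ))⁻¹)⁻¹) H.resolvent
      (H.spectralProj n x) - H.spectralProj n x := H.op_spectralProj n x

theorem truncation_mem (H : Hamiltonian E) (n : ℕ) (x : E) :
    H.truncation n x ∈ H.spectralSubspace n := by
  rw [truncation_apply_eq_cfc]
  have : H.spectralProj n x ∈ H.spectralSubspace n := Submodule.starProjection_apply_mem _ _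
  exact sub_mem (H.cfc_mem_spectralSubspace _ this) this

/-- `P_n H` maps into the range of `P_n`, so `P_n` can be moved to the other side. -/
theorem inner_truncation (H : Hamiltonian E) (n : ℕ) (x y : E) :
    inner ℂ x (H.truncation n y) = inner ℂ (H.spectralProj n x) (H.truncation n y) := by
  have h : H.spectralProj n (H.truncation n y) = H.truncation n y :=
    Submodule.starProjection_eq_self_iff.mpr (H.truncation_mem n y)
  conv_lhs => rw [← h]
  exact (Submodule.inner_starProjection_left_eq_right _ _ _).symm

theorem truncation_nonneg (H : Hamiltonian E) (n : ℕ) : 0 ≤ H.truncation n := by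
  refine nonneg_of_re_inner_nonneg ?_ fun x => ?_
  · rw [ContinuousLinearMap.isSelfAdjoint_iff_isSymmetric]
    intro x y
    simp only [ContinuousLinearMap.coe_coe]
    rw [inner_truncation, ← inner_conj_symm, inner_truncation, inner_conj_symm,
      truncation_apply, truncation_apply]
    exact H.op_symm ⟨_, H.spectralProj_mem n x⟩ ⟨_, H.spectralProj_mem n y⟩
  · rw [inner_truncation, truncation_apply]
    exact H.nonneg ⟨H.spectralProj n x, H.spectralProj_mem n x⟩

theorem norm_truncation_apply_le (H : Hamiltonian E) (n : ℕ) (x : E) :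
    ‖H.truncation n x‖ ≤ (2 + n) * ‖x‖ := by
  have hc : 0 < (1 + (n : ℝ))⁻¹ := by positivity
  have hP : ‖H.spectralProj n x‖ ≤ ‖x‖ := Submodule.norm_starProjection_apply_le _ _
  have h1 : ‖cfc (fun x : ℝ => (max x (1 + (n : ℝ))⁻¹)⁻¹) H.resolvent (H.spectralProj n x)‖
      ≤ (1 + n) * ‖H.spectralProj n x‖ := by
    have h := norm_cfc_apply_le H.resolvent_isSelfAdjoint
      (f := fun x : ℝ => (max x (1 + (n : ℝ))⁻¹)⁻¹) (g := fun _ => 1 + (n : ℝ))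
      ((continuous_id.max continuous_const).inv₀ fun x => (lt_max_of_lt_right hc).ne')
      (by fun_prop) (fun t _ => ?_) (H.spectralProj n x)
    · rwa [cfc_const _ _ H.resolvent_isSelfAdjoint, Algebra.algebraMap_eq_smul_one, smul_apply,
        one_apply_eq_self, norm_smul, Real.norm_of_nonneg (by positivity)] at h
    · rw [abs_of_pos (inv_pos.mpr (lt_max_of_lt_right hc)), abs_of_pos (by positivity)]
      exact inv_le_of_inv_le₀ (by positivity) (le_max_right _ _)
  rw [truncation_apply_eq_cfc]
  calc _ ≤ (1 + n) * ‖H.spectralProj n x‖ + ‖H.spectralProj n x‖ :=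
        (norm_sub_le _ _).trans (by gcongr)
    _ = (2 + n) * ‖H.spectralProj n x‖ := by ring
    _ ≤ _ := by gcongr

/-- A bound on `P_m H` on the `n`-th spectral subspace that does not depend on `m`. -/
theorem norm_truncation_apply_le_of_mem (H : Hamiltonian E) {n : ℕ} (m : ℕ) {x : E}
    (hx : x ∈ H.spectralSubspace n) : ‖H.truncation m x‖ ≤ (2 + n) * ‖x‖ := by
  rcases le_total m n with h | h
  · refine (H.norm_truncation_apply_le m x).trans ?_
    gcongr
  · have h1 : H.spectralProj m x = x :=
      Submodule.starProjection_eq_self_iff.mpr (H.spectralSubspace_mono h hx)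
    have h2 : H.spectralProj n x = x := Submodule.starProjection_eq_self_iff.mpr hx
    have h3 : H.truncation m x = H.truncation n x := by
      rw [truncation_apply, truncation_apply]
      congr 1
      exact Subtype.ext (h1.trans h2.symm)
    rw [h3]
    exact H.norm_truncation_apply_le n x

/-- `H` has the eigenvalue `ε i` at each vector `e i` of the Hilbert basis `e`, as expressed by
the resolvent `(1 + H)⁻¹`. -/
structure IsEigenbasis {ι : Type*} (H : Hamiltonian E) (e : HilbertBasis ι ℂ E) (ε : ι → ℝ) :
    Prop where
  nonneg : ∀ i, 0 ≤ ε i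
  resolvent_apply : ∀ i, H.resolvent (e i) = (((1 + ε i)⁻¹ : ℝ) : ℂ) • e i

/-- The eigenvectors of the resolvent are total: they span each spectral subspace by the
finite-dimensional spectral theorem, and the resolvent, which is injective, vanishes on vectors
orthogonal to all spectral subspaces. -/
theorem eq_zero_of_orthogonal_eigenvectors (H : Hamiltonian E)
    (hfin : ∀ n, FiniteDimensional ℂ (H.spectralSubspace n)) {x : E}
    (hx : ∀ (r : ℝ) (v : E), H.resolvent v = (r : ℂ) • v → inner ℂ x v = 0) : x = 0 := by
  have hle : ∀ n : ℕ, ‖H.resolvent x‖ ≤ (1 + (n : ℝ))⁻¹ * ‖x‖ := by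
    intro n
    refine H.norm_resolvent_le_of_mem_orthogonal n ?_
    rw [Submodule.mem_orthogonal']
    intro u hu
    have := hfin n
    set V := H.spectralSubspace n
    let S : V →ₗ[ℂ] V := H.resolvent.toLinearMap.restrict
      fun y hy => H.resolvent_mem_spectralSubspace hy
    have hS : S.IsSymmetric := fun y z =>
      isSelfAdjoint_inner_left H.resolvent_isSelfAdjoint (y : E) (z : E)
    let b := hS.eigenvectorBasis rfl
    have hb : ∀ i, inner ℂ x (b i : E) = 0 := fun i =>
      hx (hS.eigenvalues rfl i) (b i) (congrArg Subtype.val (hS.apply_eigenvectorBasis rfl i))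
    have hsum := congrArg (Subtype.val : V → E) (b.sum_repr ⟨u, hu⟩)
    rw [← show _ = u from hsum, Submodule.coe_sum, inner_sum]
    exact Finset.sum_eq_zero fun i _ => by
      rw [Submodule.coe_smul, inner_smul_right, hb, mul_zero]
  refine H.resolvent_eq_zero (norm_le_zero_iff.mp ?_)
  have hlim : Tendsto (fun n : ℕ => (1 + (n : ℝ))⁻¹ * ‖x‖) atTop (𝓝 (0 * ‖x‖)) :=
    (tendsto_inv_atTop_zero.comp
      (tendsto_atTop_add_const_left _ 1 tendsto_natCast_atTop_atTop)).mul_const _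
  rw [zero_mul] at hlim
  exact ge_of_tendsto' hlim hle

/-- The basis is the union of Hilbert bases of the eigenspaces of the resolvent for the real numbers
`r`; the eigenspaces for `r ∉ (0, 1]` vanish, and `ε = r⁻¹ - 1`. -/
theorem exists_isEigenbasis.{u} {E : Type u} [NormedAddCommGroup E] [InnerProductSpace ℂ E]
    [CompleteSpace E] (H : Hamiltonian E)
    (hfin : ∀ n, FiniteDimensional ℂ (H.spectralSubspace n)) :
    ∃ (ι : Type u) (e : HilbertBasis ι ℂ E) (ε : ι → ℝ), H.IsEigenbasis e ε := by
  let R := H.resolvent.toLinearMap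
  have hR : R.IsSymmetric := fun y z => isSelfAdjoint_inner_left H.resolvent_isSelfAdjoint y z
  let G : ℝ → Submodule ℂ E := fun r => Module.End.eigenspace R (r : ℂ)
  have hG : OrthogonalFamily ℂ (fun r => G r) fun r => (G r).subtypeₗᵢ :=
    hR.orthogonalFamily_eigenspaces.comp Complex.ofReal_injective
  have hGmem : ∀ r v, v ∈ G r ↔ H.resolvent v = (r : ℂ) • v := fun r v =>
    Module.End.mem_eigenspace_iff
  have hcl : ∀ r, CompleteSpace (G r) := by
    intro r
    have : IsClosed (G r : Set E) := by
      have h : (G r : Set E) = {v | H.resolvent v = (r : ℂ) • v} := Set.ext fun v => hGmem r v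
      rw [h]
      exact isClosed_eq (by fun_prop) (by fun_prop)
    exact this.completeSpace_coe
  choose w b hb using fun r => exists_hilbertBasis ℂ (G r)
  have horth := hG.orthonormal_sigma_orthonormal (v_family := fun r => b r)
    fun r => (b r).orthonormal
  have hspan : (Submodule.span ℂ
      (Set.range fun a : (Σ r, w r) => ((G a.1).subtypeₗᵢ (b a.1 a.2))))ᗮ = ⊥ := by
    rw [Submodule.eq_bot_iff]
    intro x hx
    rw [Submodule.mem_orthogonal'] at hx
    refine H.eq_zero_of_orthogonal_eigenvectors hfin fun r v hv => ?_
    have h1 := ((b r).hasSum_repr ⟨v, (hGmem r v).mpr hv⟩).mapL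
      ((innerSL ℂ x).comp (G r).subtypeL)
    have h2 : ∀ i, ((innerSL ℂ x).comp (G r).subtypeL)
        ((b r).repr ⟨v, (hGmem r v).mpr hv⟩ i • b r i) = 0 := by
      intro i
      rw [map_smul]
      have : inner ℂ x (b r i : E) = 0 := hx _ (Submodule.subset_span ⟨⟨r, i⟩, rfl⟩)
      simp [this]
    simp only [h2] at h1
    exact h1.unique hasSum_zero
  let e := HilbertBasis.mkOfOrthogonalEqBot horth hspan
  have he : ∀ a, H.resolvent (e a) = (a.1 : ℂ) • e a := by
    intro a
    have : e a = (b a.1 a.2 : E) := by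
      simp only [e, HilbertBasis.coe_mkOfOrthogonalEqBot]
      rfl
    rw [this]
    exact (hGmem _ _).mp (b a.1 a.2).2
  have hpos : ∀ a : (Σ r, w r), 0 < a.1 ∧ a.1 ≤ 1 := by
    intro a
    have hn : ‖e a‖ = 1 := e.orthonormal.norm_eq_one a
    have h1 := (ContinuousLinearMap.nonneg_iff_isPositive _ |>.mp
      H.resolvent_nonneg).re_inner_nonneg_right (e a)
    have h2 := H.norm_resolvent_apply_le (e a)
    have h3 : a.1 ≠ 0 := by
      intro h0
      have := H.resolvent_eq_zero (y := e a) (by rw [he, h0]; simp)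
      simp [this] at hn
    rw [he, inner_smul_right, inner_self_eq_norm_sq_to_K, hn] at h1
    rw [he, norm_smul, hn, mul_one, Complex.norm_real] at h2
    have h1' : 0 ≤ a.1 := by simpa using h1
    exact ⟨lt_of_le_of_ne h1' h3.symm, (le_abs_self _).trans h2⟩
  refine ⟨Σ r, w r, e, fun a => a.1⁻¹ - 1, fun a => ?_, fun a => ?_⟩
  · exact sub_nonneg.mpr ((one_le_inv₀ (hpos a).1).mpr (hpos a).2)
  · rw [he, add_sub_cancel, inv_inv]

end Hamiltonian

/-! ### Diagonal states -/

section DiagonalState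

variable {E : Type*} [NormedAddCommGroup E] [InnerProductSpace ℂ E] {ι : Type*}

theorem re_inner_of_apply_eq_smul (b : HilbertBasis ι ℂ E) {T : E →L[ℂ] E} {r : ℝ} {i : ι}
    (h : T (b i) = (r : ℂ) • b i) : (inner ℂ (b i) (T (b i))).re = r := by
  rw [h, inner_smul_right, inner_self_eq_norm_sq_to_K, b.orthonormal.norm_eq_one]
  simp

theorem traceIn_of_apply_eq_smul (b : HilbertBasis ι ℂ E) {T : E →L[ℂ] E} {p : ι → ℝ}
    (h : ∀ i, T (b i) = (p i : ℂ) • b i) : traceIn b T = ∑' i, ENNReal.ofReal (p i) :=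
  tsum_congr fun i => by rw [re_inner_of_apply_eq_smul b (h i)]

/-- The operator `∑_{k ∈ s} p_k |b_k⟩⟨b_k|`. -/
noncomputable def diagonalOp (b : HilbertBasis ι ℂ E) (s : Finset ι) (p : ι → ℝ) : E →L[ℂ] E :=
  ∑ k ∈ s, (p k : ℂ) • InnerProductSpace.rankOne ℂ (b k) (b k)

open scoped Classical in
theorem diagonalOp_apply (b : HilbertBasis ι ℂ E) (s : Finset ι) (p : ι → ℝ) (i : ι) :
    diagonalOp b s p (b i) = ((if i ∈ s then p i else 0 : ℝ) : ℂ) • b i := by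
  rw [diagonalOp, sum_apply]
  simp only [smul_apply, InnerProductSpace.rankOne_apply,
    orthonormal_iff_ite.mp b.orthonormal]
  by_cases hi : i ∈ s
  · rw [Finset.sum_eq_single_of_mem i hi (fun k _ hk => by simp [hk])]
    simp [hi]
  · rw [Finset.sum_eq_zero fun k hk => by simp [show k ≠ i from fun h => hi (h ▸ hk)]]
    simp [hi]

variable [CompleteSpace E]

theorem traceIn_sqrt_mul_mul_sqrt (b : HilbertBasis ι ℂ E) {ρ : E →L[ℂ] E} (hρ : 0 ≤ ρ)
    {p : ι → ℝ} (hp : ∀ i, 0 ≤ p i) (h : ∀ i, ρ (b i) = (p i : ℂ) • b i) (T : E →L[ℂ] E) :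
    traceIn b (CFC.sqrt ρ * T * CFC.sqrt ρ)
      = ∑' i, ENNReal.ofReal (p i * (inner ℂ (b i) (T (b i))).re) := by
  refine tsum_congr fun i => ?_
  rw [_root_.mul_apply_eq_comp, _root_.mul_apply_eq_comp, ← inner_sqrt_left,
    sqrt_apply_of_apply_eq_smul hρ (h i), map_smul, inner_smul_left, inner_smul_right,
    Complex.conj_ofReal, ← mul_assoc, ← Complex.ofReal_mul, Real.mul_self_sqrt (hp i),
    Complex.re_ofReal_mul]

open scoped ComplexOrder in
theorem diagonalOp_nonneg (b : HilbertBasis ι ℂ E) {s : Finset ι} {p : ι → ℝ}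
    (hp : ∀ i ∈ s, 0 ≤ p i) : 0 ≤ diagonalOp b s p :=
  Finset.sum_nonneg fun k hk => (ContinuousLinearMap.nonneg_iff_isPositive _).mpr
    ((InnerProductSpace.isPositive_rankOne_self (b k)).smul_of_nonneg
      (Complex.zero_le_real.mpr (hp k hk)))

/-- Every probability distribution on finitely many vectors of a Hilbert basis bounds the maximal
entropy from below, through the corresponding diagonal state. -/
theorem Hamiltonian.le_maxEntropy (H : Hamiltonian E) (b : HilbertBasis ι ℂ E) {s : Finset ι}
    {p h : ι → ℝ} (hp : ∀ i ∈ s, 0 ≤ p i) (hsum : ∑ i ∈ s, p i = 1)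
    (hh : ∀ m, ∀ i ∈ s, (inner ℂ (b i) (H.truncation m (b i))).re ≤ h i) :
    ENNReal.ofReal (∑ i ∈ s, Real.negMulLog (p i)) ≤ H.maxEntropy (∑ i ∈ s, p i * h i) := by
  classical
  set q : ι → ℝ := fun i => if i ∈ s then p i else 0 with hq
  set ρ := diagonalOp b s p with hρdef
  have hρ : 0 ≤ ρ := diagonalOp_nonneg b hp
  have hρb : ∀ i, ρ (b i) = (q i : ℂ) • b i := fun i => by
    rw [hρdef, diagonalOp_apply]
  have hq0 : ∀ i, 0 ≤ q i := fun i => by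
    by_cases hi : i ∈ s <;> simp [hq, hi, hp]
  have hstate : IsState ρ := by
    refine ⟨hρ, ?_⟩
    rw [opTrace_eq_traceIn b hρ, traceIn_of_apply_eq_smul b hρb,
      tsum_eq_sum (s := s) (fun i hi => by simp [hq, hi]),
      ← ENNReal.ofReal_sum_of_nonneg fun i _ => hq0 i,
      Finset.sum_congr rfl fun i hi => show q i = p i by simp [hq, hi], hsum, ENNReal.ofReal_one]
  have henergy : H.energy ρ ≤ ENNReal.ofReal (∑ i ∈ s, p i * h i) := by
    refine iSup_le fun m => ?_
    rw [opTrace_eq_traceIn b (conjugate_nonneg_of_nonneg (H.truncation_nonneg m)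
      (CFC.sqrt_nonneg ρ)), traceIn_sqrt_mul_mul_sqrt b hρ hq0 hρb,
      tsum_eq_sum (s := s) (fun i hi => by simp [hq, hi]), ← ENNReal.ofReal_sum_of_nonneg]
    · refine ENNReal.ofReal_le_ofReal (Finset.sum_le_sum fun i hi => ?_)
      rw [show q i = p i by simp [hq, hi]]
      exact mul_le_mul_of_nonneg_left (hh m i hi) (hp i hi)
    · exact fun i _ => mul_nonneg (hq0 i) ((ContinuousLinearMap.nonneg_iff_isPositive _ |>.mp
        (H.truncation_nonneg m)).re_inner_nonneg_right (b i))
  have hle1 : ∀ i ∈ s, p i ≤ 1 := fun i hi => hsum ▸ Finset.single_le_sum hp hi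
  have hentropy : vonNeumannEntropy ρ = ENNReal.ofReal (∑ i ∈ s, Real.negMulLog (p i)) := by
    have hη : ∀ i, cfc Real.negMulLog ρ (b i) = (Real.negMulLog (q i) : ℂ) • b i := fun i =>
      cfc_apply_of_apply_eq_smul hρ.isSelfAdjoint Real.continuous_negMulLog (hρb i)
    rw [vonNeumannEntropy, opTrace_eq_traceIn b hstate.negMulLog_nonneg,
      traceIn_of_apply_eq_smul b hη, tsum_eq_sum (s := s) (fun i hi => by simp [hq, hi]),
      ENNReal.ofReal_sum_of_nonneg fun i hi => Real.negMulLog_nonneg (hp i hi) (hle1 i hi)]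
    exact Finset.sum_congr rfl fun i hi => by simp [hq, hi]
  rw [← hentropy]
  exact le_iSup_of_le ρ (le_iSup_of_le hstate (le_iSup_of_le henergy le_rfl))

end DiagonalState

/-! ### Finite dimension of the spectral subspaces -/

namespace Hamiltonian

variable {E : Type*} [NormedAddCommGroup E] [InnerProductSpace ℂ E] [CompleteSpace E]

theorem maxEntropy_mono (H : Hamiltonian E) : Monotone H.maxEntropy := fun _ _ hxy =>
  iSup_mono fun _ => iSup_mono fun _ => iSup_mono' fun h =>
    ⟨h.trans (ENNReal.ofReal_le_ofReal hxy), le_rfl⟩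

/-- Uniform states on orthonormal families in a spectral subspace: an infinite-dimensional
spectral subspace carries states of bounded energy and arbitrarily large entropy. -/
theorem finiteDimensional_of_maxEntropy (H : Hamiltonian E)
    (hF : ∃ᶠ x in atTop, H.maxEntropy x ≠ ∞) (n : ℕ) :
    FiniteDimensional ℂ (H.spectralSubspace n) := by
  obtain ⟨x, hx, hFx⟩ := (frequently_atTop.mp hF) (2 + n)
  refine finiteDimensional_of_forall_hilbertBasis _ ⌈Real.exp (H.maxEntropy x).toReal⌉₊
    fun w b s hs => ?_
  rcases s.eq_empty_or_nonempty with rfl | hne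
  · simp
  have hN : (0 : ℝ) < s.card := by exact_mod_cast hne.card_pos
  have h1 := H.le_maxEntropy b (s := s) (p := fun _ => (s.card : ℝ)⁻¹) (h := fun _ => 2 + (n : ℝ))
    (fun _ _ => by positivity) (by simp [hN.ne']) fun m i hi => by
      have hb : ‖b i‖ = 1 := b.orthonormal.norm_eq_one i
      calc _ ≤ ‖inner ℂ (b i) (H.truncation m (b i))‖ := Complex.re_le_norm _
        _ ≤ ‖b i‖ * ‖H.truncation m (b i)‖ := norm_inner_le_norm _ _
        _ ≤ ‖b i‖ * ((2 + n) * ‖b i‖) := by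
          gcongr; exact H.norm_truncation_apply_le_of_mem m (hs i hi)
        _ = 2 + n := by rw [hb]; ring
  have h2 : ∑ _i ∈ s, (s.card : ℝ)⁻¹ * (2 + (n : ℝ)) = 2 + n := by
    rw [Finset.sum_const, nsmul_eq_mul]; field_simp
  have h3 : ∑ _i ∈ s, Real.negMulLog (s.card : ℝ)⁻¹ = Real.log s.card := by
    rw [Finset.sum_const, nsmul_eq_mul, Real.negMulLog, Real.log_inv]; field_simp
  rw [h2, h3] at h1
  have h4 := (ENNReal.ofReal_le_iff_le_toReal hFx).mp (h1.trans (H.maxEntropy_mono hx))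
  have h5 := (Real.log_le_iff_le_exp hN).mp h4
  exact_mod_cast h5.trans (Nat.le_ceil _)

/-- The function defining `e^{-tH}` is `x ↦ e^t exp(-(x / t)⁻¹)` for `x > 0`, a rescaled
`expNegInvGlue`. -/
theorem expNeg_continuous {t : ℝ} (ht : 0 < t) :
    Continuous fun x : ℝ => if x ≤ 0 then 0 else Real.exp (-t * (x⁻¹ - 1)) := by
  have h : (fun x : ℝ => if x ≤ 0 then 0 else Real.exp (-t * (x⁻¹ - 1)))
      = fun x => Real.exp t * expNegInvGlue (x / t) := by
    funext x
    rw [expNegInvGlue]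
    by_cases hx : x ≤ 0
    · rw [if_pos hx, if_pos (div_nonpos_of_nonpos_of_nonneg hx ht.le), mul_zero]
    · rw [if_neg hx, if_neg (not_le.mpr (div_pos (not_le.mp hx) ht)), ← Real.exp_add]
      congr 1
      rw [inv_div]
      ring
  rw [h]
  exact continuous_const.mul ((expNegInvGlue.contDiff (n := 0)).continuous.comp
    (continuous_id.div_const t))

theorem expNeg_nonneg (H : Hamiltonian E) (t : ℝ) : 0 ≤ H.expNeg t :=
  cfc_nonneg fun x _ => by split_ifs <;> positivity

theorem spectrum_resolvent_le_one (H : Hamiltonian E) {t : ℝ} (ht : t ∈ spectrum ℝ H.resolvent) :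
    t ≤ 1 := by
  have h1 : ‖H.resolvent‖ ≤ 1 := ContinuousLinearMap.opNorm_le_bound _ zero_le_one fun x => by
    rw [one_mul]; exact H.norm_resolvent_apply_le x
  have h2 : ‖(1 : E →L[ℂ] E)‖ ≤ 1 := ContinuousLinearMap.norm_id_le
  exact (le_abs_self t).trans ((spectrum.norm_le_norm_mul_of_mem ht).trans
    (mul_le_one₀ h1 (norm_nonneg _) h2))

theorem le_re_inner_resolvent (H : Hamiltonian E) {n : ℕ} {x : E}
    (hx : x ∈ H.spectralSubspace n) :
    (1 + (n : ℝ))⁻¹ * ‖x‖ ^ 2 ≤ (inner ℂ x (H.resolvent x)).re := by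
  have h := re_inner_mono (cfc_mono (a := H.resolvent) (f := fun t : ℝ => (1 + (n : ℝ))⁻¹ - t)
    (g := fun t => max ((1 + (n : ℝ))⁻¹ - t) 0) (fun t _ => le_max_left _ _) (by fun_prop)
    (by fun_prop)) x
  rw [(H.mem_spectralSubspace n x).mp hx, inner_zero_right, Complex.zero_re,
    cfc_sub _ _ H.resolvent (by fun_prop) (by fun_prop), cfc_const _ _ H.resolvent_isSelfAdjoint,
    cfc_id' ℝ H.resolvent H.resolvent_isSelfAdjoint, sub_apply, inner_sub_right, Complex.sub_re,
    Algebra.algebraMap_eq_smul_one, smul_apply, one_apply_eq_self, inner_smul_right_eq_smul,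
    Complex.smul_re] at h
  have h2 : (inner ℂ x x).re = ‖x‖ ^ 2 := inner_self_eq_norm_sq (𝕜 := ℂ) x
  rw [h2, smul_eq_mul] at h
  linarith

/-- On the `n`-th spectral subspace `e^{-tH}` is bounded below, so that this subspace has finite
dimension when `e^{-tH}` has finite trace. -/
theorem finiteDimensional_of_opTrace_expNeg (H : Hamiltonian E) {t : ℝ} (ht : 0 < t)
    (hfin : opTrace (H.expNeg t) ≠ ∞) (n : ℕ) :
    FiniteDimensional ℂ (H.spectralSubspace n) := by
  set f : ℝ → ℝ := fun x => if x ≤ 0 then 0 else Real.exp (-t * (x⁻¹ - 1)) with hf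
  set c : ℝ := (1 + (n : ℝ))⁻¹ with hc
  have hc0 : 0 < c := by positivity
  set δ : ℝ := Real.exp (-t * ((c / 2)⁻¹ - 1)) with hδ
  have hδ0 : 0 < δ := Real.exp_pos _
  -- an affine minorant of `f` on `[0, 1]` that is positive on `[c, 1]`
  have hmin : ∀ x ∈ spectrum ℝ H.resolvent, δ * (x - c / 2) ≤ f x := by
    intro x hx
    rcases le_total x (c / 2) with h | h
    · refine (mul_nonpos_of_nonneg_of_nonpos hδ0.le (sub_nonpos.mpr h)).trans ?_
      simp only [hf]
      split_ifs <;> positivity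
    · have hx0 : 0 < x := lt_of_lt_of_le (by positivity) h
      simp only [hf]
      rw [if_neg hx0.not_ge]
      calc δ * (x - c / 2) ≤ δ * 1 := by
            gcongr
            linarith [H.spectrum_resolvent_le_one hx]
        _ ≤ _ := by
            rw [mul_one, hδ, Real.exp_le_exp, neg_mul, neg_mul, neg_le_neg_iff]
            gcongr
  have hlow : ∀ x ∈ H.spectralSubspace n, δ * (c / 2) * ‖x‖ ^ 2 ≤
      (inner ℂ x (H.expNeg t x)).re := by
    intro x hx
    have h := re_inner_mono (cfc_mono (a := H.resolvent) hmin (by fun_prop)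
      (expNeg_continuous ht).continuousOn) x
    refine le_trans ?_ h
    have h1 := H.le_re_inner_resolvent hx
    have h2 : (inner ℂ x x).re = ‖x‖ ^ 2 := inner_self_eq_norm_sq (𝕜 := ℂ) x
    rw [cfc_const_mul _ _ H.resolvent (by fun_prop), cfc_sub _ _ H.resolvent (by fun_prop)
      (by fun_prop), cfc_const _ _ H.resolvent_isSelfAdjoint,
      cfc_id' ℝ H.resolvent H.resolvent_isSelfAdjoint, smul_apply, sub_apply,
      inner_smul_right_eq_smul, Complex.smul_re, inner_sub_right, Complex.sub_re,
      Algebra.algebraMap_eq_smul_one, smul_apply, one_apply_eq_self, inner_smul_right_eq_smul,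
      Complex.smul_re, h2, smul_eq_mul, smul_eq_mul, mul_assoc]
    gcongr
    rw [← hc] at h1
    linarith
  refine finiteDimensional_of_forall_hilbertBasis _
    ⌈(opTrace (H.expNeg t)).toReal / (δ * (c / 2))⌉₊ fun w b s hs => ?_
  have h1 : (s.card : ℝ≥0∞) * ENNReal.ofReal (δ * (c / 2)) ≤ opTrace (H.expNeg t) := by
    rw [opTrace_eq_traceIn b (H.expNeg_nonneg t), ← nsmul_eq_mul, ← Finset.sum_const]
    refine (Finset.sum_le_sum fun i hi => ENNReal.ofReal_le_ofReal ?_).trans (ENNReal.sum_le_tsum s)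
    have := hlow (b i) (hs i hi)
    rwa [b.orthonormal.norm_eq_one, one_pow, mul_one] at this
  rw [← ENNReal.ofReal_natCast, ← ENNReal.ofReal_mul (by positivity),
    ENNReal.ofReal_le_iff_le_toReal hfin, ← le_div_iff₀ (by positivity)] at h1
  exact_mod_cast h1.trans (Nat.le_ceil _)

end Hamiltonian

namespace Hamiltonian

variable {E : Type*} [NormedAddCommGroup E] [InnerProductSpace ℂ E] [CompleteSpace E]
variable {ι : Type*} {H : Hamiltonian E} {e : HilbertBasis ι ℂ E} {ε : ι → ℝ}

/-! ### Trace, energy and entropy in an eigenbasis -/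

theorem IsEigenbasis.expNeg_apply (he : H.IsEigenbasis e ε) {t : ℝ} (ht : 0 < t) (i : ι) :
    H.expNeg t (e i) = (Real.exp (-t * ε i) : ℂ) • e i := by
  have h0 := he.nonneg i
  have h := cfc_apply_of_apply_eq_smul H.resolvent_isSelfAdjoint (expNeg_continuous ht)
    (he.resolvent_apply i)
  rwa [if_neg (not_le.mpr (by positivity)), inv_inv, add_sub_cancel_left] at h

theorem IsEigenbasis.opTrace_expNeg (he : H.IsEigenbasis e ε) {t : ℝ} (ht : 0 < t) :
    opTrace (H.expNeg t) = ∑' i, ENNReal.ofReal (Real.exp (-t * ε i)) := by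
  rw [opTrace_eq_traceIn e (H.expNeg_nonneg t), traceIn_of_apply_eq_smul e (he.expNeg_apply ht)]

theorem IsEigenbasis.truncation_apply (he : H.IsEigenbasis e ε) (n : ℕ) (i : ι) :
    H.truncation n (e i) = ((if ε i ≤ n then ε i else 0 : ℝ) : ℂ) • e i := by
  have h0 := he.nonneg i
  have hA := cfc_apply_of_apply_eq_smul H.resolvent_isSelfAdjoint
    (f := fun x : ℝ => max ((1 + (n : ℝ))⁻¹ - x) 0) (by fun_prop) (he.resolvent_apply i)
  have hAsa : IsSelfAdjoint (cfc (fun x : ℝ => max ((1 + (n : ℝ))⁻¹ - x) 0) H.resolvent) :=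
    cfc_predicate _ _
  rw [truncation_apply_eq_cfc]
  by_cases h : ε i ≤ n
  · have hle : (1 + (n : ℝ))⁻¹ ≤ (1 + ε i)⁻¹ := by gcongr
    have hmem : e i ∈ H.spectralSubspace n := by
      rw [mem_spectralSubspace, hA, max_eq_right (sub_nonpos.mpr hle), Complex.ofReal_zero,
        zero_smul]
    have hcont : Continuous fun x : ℝ => (max x (1 + (n : ℝ))⁻¹)⁻¹ :=
      (continuous_id.max continuous_const).inv₀ fun x =>
        (lt_max_of_lt_right (by positivity)).ne'
    rw [show H.spectralProj n (e i) = e i from Submodule.starProjection_eq_self_iff.mpr hmem,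
      cfc_apply_of_apply_eq_smul H.resolvent_isSelfAdjoint hcont (he.resolvent_apply i),
      max_eq_left hle, inv_inv, if_pos h]
    simp [add_smul]
  · have hlt : (1 + ε i)⁻¹ < (1 + (n : ℝ))⁻¹ := by
      have := not_le.mp h
      gcongr
    have horth : e i ∈ (H.spectralSubspace n)ᗮ := by
      rw [Submodule.mem_orthogonal']
      intro u hu
      rw [mem_spectralSubspace] at hu
      have h1 := isSelfAdjoint_inner_left hAsa (e i) u
      rw [hu, hA, inner_zero_right, inner_smul_left, max_eq_left (sub_nonneg.mpr hlt.le)] at h1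
      refine (mul_eq_zero.mp h1).resolve_left ?_
      rw [Complex.conj_ofReal]
      exact Complex.ofReal_ne_zero.mpr (sub_pos.mpr hlt).ne'
    rw [show H.spectralProj n (e i) = 0 from
      (Submodule.starProjection_apply_eq_zero_iff _).mpr horth, if_neg h]
    simp

/-- The trace `Tr P_n H ρ` for a `ρ` that need not be diagonal in the basis `e`: `‖√T √ρ e_i‖²`,
for `T = P_n H`, is expanded in the basis `e`, and the sum over `i` is carried out first. -/
theorem IsEigenbasis.opTrace_sqrt_mul_truncation_mul_sqrt (he : H.IsEigenbasis e ε)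
    (ρ : E →L[ℂ] E) (hρ : 0 ≤ ρ) (n : ℕ) :
    opTrace (CFC.sqrt ρ * H.truncation n * CFC.sqrt ρ) =
      ∑' j, ENNReal.ofReal (if ε j ≤ n then ε j else 0) *
        ENNReal.ofReal (inner ℂ (e j) (ρ (e j))).re := by
  have hT := H.truncation_nonneg n
  have hτ : ∀ j, 0 ≤ (if ε j ≤ n then ε j else 0) := fun j => by
    split_ifs
    exacts [he.nonneg j, le_rfl]
  have hterm : ∀ i, ENNReal.ofReal (inner ℂ (e i)
      ((CFC.sqrt ρ * H.truncation n * CFC.sqrt ρ) (e i))).re =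
      ∑' j, ENNReal.ofReal (if ε j ≤ n then ε j else 0) *
        ‖inner ℂ (e i) (CFC.sqrt ρ (e j))‖ₑ ^ 2 := by
    intro i
    rw [_root_.mul_apply_eq_comp, _root_.mul_apply_eq_comp, ← inner_sqrt_left,
      ofReal_re_inner_eq_enorm_sqrt_sq hT, ← tsum_enorm_inner_sq e]
    refine tsum_congr fun j => ?_
    rw [← inner_sqrt_left, sqrt_apply_of_apply_eq_smul hT (he.truncation_apply n j),
      inner_smul_left, ← inner_sqrt_left, enorm_mul, mul_pow, Complex.conj_ofReal]
    congr 1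
    · rw [← ofReal_norm, Complex.norm_real, Real.norm_of_nonneg (Real.sqrt_nonneg _),
        ← ENNReal.ofReal_pow (Real.sqrt_nonneg _), Real.sq_sqrt (hτ j)]
    · rw [← ofReal_norm, norm_inner_symm, ofReal_norm]
  rw [opTrace_eq_traceIn e (conjugate_nonneg_of_nonneg hT (CFC.sqrt_nonneg ρ)), traceIn]
  simp_rw [hterm]
  rw [ENNReal.tsum_comm]
  refine tsum_congr fun j => ?_
  rw [ENNReal.tsum_mul_left, tsum_enorm_inner_sq, ofReal_re_inner_eq_enorm_sqrt_sq hρ]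

theorem IsEigenbasis.tsum_le_energy (he : H.IsEigenbasis e ε) (ρ : E →L[ℂ] E) (hρ : 0 ≤ ρ) :
    ∑' j, ENNReal.ofReal (ε j) * ENNReal.ofReal (inner ℂ (e j) (ρ (e j))).re ≤ H.energy ρ := by
  rw [ENNReal.tsum_eq_iSup_sum]
  refine iSup_le fun s => ?_
  -- finitely many eigenvalues all lie below some cutoff `n`
  obtain ⟨M, hM⟩ := (s.image ε).exists_le
  obtain ⟨n, hn⟩ := exists_nat_ge M
  refine le_iSup_of_le n ?_
  rw [he.opTrace_sqrt_mul_truncation_mul_sqrt ρ hρ]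
  refine le_trans (le_of_eq (Finset.sum_congr rfl fun j hj => ?_)) (ENNReal.sum_le_tsum s)
  rw [if_pos ((hM _ (Finset.mem_image_of_mem ε hj)).trans hn)]

/-- `log y ≤ y - 1` at `y = g / x`. -/
theorem _root_.Real.negMulLog_le {x g : ℝ} (hx : 0 ≤ x) (hg : 0 < g) :
    Real.negMulLog x ≤ x * -Real.log g + (g - x) := by
  rcases hx.eq_or_lt with rfl | hx
  · simpa using hg.le
  · have h := Real.log_le_sub_one_of_pos (div_pos hg hx)
    rw [Real.log_div hg.ne' hx.ne'] at h
    have h2 := mul_le_mul_of_nonneg_left h hx.le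
    have h3 : x * (g / x - 1) = g - x := by field_simp
    rw [h3] at h2
    rw [Real.negMulLog]
    linarith

/-- The Gibbs variational inequality `S(ρ) ≤ t Tr Hρ + log Z` for `Tr e^{-tH} ≤ Z`. It comes from
the operator inequalities `η(ρ) ≤ -ρ log g + g - ρ` for scalars `g > 0`: the one with
`g = e^{-t ε j} / Z` is evaluated at the eigenvector `e j`, and these are summed over `j`. -/
theorem IsEigenbasis.vonNeumannEntropy_le (he : H.IsEigenbasis e ε) {ρ : E →L[ℂ] E}
    (hρ : IsState ρ) {t Z : ℝ} (ht : 0 < t) (hZ : 1 ≤ Z)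
    (hZt : opTrace (H.expNeg t) ≤ ENNReal.ofReal Z) :
    vonNeumannEntropy ρ ≤ ENNReal.ofReal t * H.energy ρ + ENNReal.ofReal (Real.log Z) := by
  have hZ0 : 0 < Z := zero_lt_one.trans_le hZ
  set q : ι → ℝ := fun j => (inner ℂ (e j) (ρ (e j))).re with hq
  set g : ι → ℝ := fun j => Real.exp (-t * ε j) / Z with hg
  have hg0 : ∀ j, 0 < g j := fun j => by positivity
  have hq0 : ∀ j, 0 ≤ q j := fun j =>
    (ContinuousLinearMap.nonneg_iff_isPositive _ |>.mp hρ.1).re_inner_nonneg_right (e j)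
  have hL : 0 ≤ Real.log Z := Real.log_nonneg hZ
  have hterm : ∀ j, ENNReal.ofReal (inner ℂ (e j) (cfc Real.negMulLog ρ (e j))).re
      + ENNReal.ofReal (q j) ≤ ENNReal.ofReal t * (ENNReal.ofReal (ε j) * ENNReal.ofReal (q j))
        + ENNReal.ofReal (Real.log Z) * ENNReal.ofReal (q j) + ENNReal.ofReal (g j) := by
    intro j
    have h1 := re_inner_mono (cfc_mono (a := ρ) (f := Real.negMulLog)
      (g := fun x => (-Real.log (g j) - 1) * x + g j) (fun x hx => by
        have := Real.negMulLog_le (hρ.spectrum_subset hx).1 (hg0 j)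
        linarith) (by fun_prop) (by fun_prop)) (e j)
    have h2 : (inner ℂ (e j) (e j)).re = 1 := by
      rw [inner_self_eq_norm_sq_to_K, e.orthonormal.norm_eq_one]; simp
    rw [cfc_add _ (fun x => (-Real.log (g j) - 1) * x) (fun _ => g j) (by fun_prop) (by fun_prop),
      cfc_const_mul _ _ ρ (by fun_prop), cfc_const _ _ hρ.1.isSelfAdjoint,
      cfc_id' ℝ ρ hρ.1.isSelfAdjoint, add_apply, smul_apply, Algebra.algebraMap_eq_smul_one,
      smul_apply, one_apply_eq_self, inner_add_right, inner_smul_right_eq_smul,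
      inner_smul_right_eq_smul, Complex.add_re, Complex.smul_re, Complex.smul_re, h2,
      smul_eq_mul, smul_eq_mul] at h1
    have h3 : -Real.log (g j) = t * ε j + Real.log Z := by
      rw [hg, Real.log_div (Real.exp_pos _).ne' hZ0.ne', Real.log_exp]; ring
    have h4 : 0 ≤ (inner ℂ (e j) (cfc Real.negMulLog ρ (e j))).re :=
      (ContinuousLinearMap.nonneg_iff_isPositive _ |>.mp
        hρ.negMulLog_nonneg).re_inner_nonneg_right (e j)
    have h5 := he.nonneg j
    have h6 := hq0 j
    rw [← ENNReal.ofReal_mul h5, ← ENNReal.ofReal_mul ht.le, ← ENNReal.ofReal_mul hL,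
      ← ENNReal.ofReal_add h4 h6, ← ENNReal.ofReal_add (by positivity) (by positivity),
      ← ENNReal.ofReal_add (by positivity) (hg0 j).le]
    refine ENNReal.ofReal_le_ofReal ?_
    rw [h3] at h1
    change _ ≤ (_ - 1) * q j + _ at h1
    linarith
  have hqsum : ∑' j, ENNReal.ofReal (q j) = 1 := by
    rw [← hρ.2, opTrace_eq_traceIn e hρ.1, traceIn]
  have hgsum : ∑' j, ENNReal.ofReal (g j) ≤ 1 := by
    simp_rw [hg, ENNReal.ofReal_div_of_pos hZ0, div_eq_mul_inv]
    rw [ENNReal.tsum_mul_right, ← he.opTrace_expNeg ht, ← div_eq_mul_inv]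
    exact ENNReal.div_le_of_le_mul (by rwa [one_mul])
  have hsum := ENNReal.tsum_le_tsum hterm
  rw [ENNReal.tsum_add, ENNReal.tsum_add, ENNReal.tsum_add, ENNReal.tsum_mul_left,
    ENNReal.tsum_mul_left, hqsum, mul_one] at hsum
  rw [vonNeumannEntropy, opTrace_eq_traceIn e hρ.negMulLog_nonneg, traceIn]
  refine (ENNReal.add_le_add_iff_right ENNReal.one_ne_top).mp (hsum.trans ?_)
  gcongr
  exact he.tsum_le_energy ρ hρ.1

theorem IsEigenbasis.maxEntropy_le (he : H.IsEigenbasis e ε) {t Z x : ℝ} (ht : 0 < t) (hZ : 1 ≤ Z)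
    (hx : 0 ≤ x) (hZt : opTrace (H.expNeg t) ≤ ENNReal.ofReal Z) :
    H.maxEntropy x ≤ ENNReal.ofReal (t * x + Real.log Z) := by
  refine iSup_le fun ρ => iSup_le fun hρ => iSup_le fun hE => ?_
  rw [ENNReal.ofReal_add (by positivity) (Real.log_nonneg hZ), ENNReal.ofReal_mul ht.le]
  refine (he.vonNeumannEntropy_le hρ ht hZ hZt).trans ?_
  gcongr

/-- Gibbs states of finite parts of the spectrum: if `F_H(x) ≤ k √x` for large `x`, they give
`log Z ≤ F_H(m) - t m ≤ k √m - t m + O(1)` at their mean energy `m`, and `k √m - t m` is at most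
`k² / (4 t)`. -/
theorem IsEigenbasis.opTrace_expNeg_le (he : H.IsEigenbasis e ε) {k X t : ℝ} (hk : 0 ≤ k)
    (ht : 0 < t) (hF : ∀ x, X ≤ x → H.maxEntropy x ≤ ENNReal.ofReal (k * √x)) :
    opTrace (H.expNeg t) ≤ ENNReal.ofReal (Real.exp (k ^ 2 / (4 * t) + k * √X)) := by
  rw [he.opTrace_expNeg ht, ENNReal.tsum_eq_iSup_sum]
  refine iSup_le fun s => ?_
  rcases s.eq_empty_or_nonempty with rfl | hne
  · simp
  rw [← ENNReal.ofReal_sum_of_nonneg fun i _ => (Real.exp_pos _).le]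
  refine ENNReal.ofReal_le_ofReal ?_
  set Z : ℝ := ∑ i ∈ s, Real.exp (-t * ε i) with hZ
  have hZ0 : 0 < Z := Finset.sum_pos (fun i _ => Real.exp_pos _) hne
  set p : ι → ℝ := fun i => Real.exp (-t * ε i) / Z with hp
  have hsum : ∑ i ∈ s, p i = 1 := by rw [← Finset.sum_div, ← hZ, div_self hZ0.ne']
  set m : ℝ := ∑ i ∈ s, p i * ε i with hm
  have hm0 : 0 ≤ m := Finset.sum_nonneg fun i _ =>
    mul_nonneg (div_nonneg (Real.exp_pos _).le hZ0.le) (he.nonneg i)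
  have h1 := H.le_maxEntropy e (s := s) (p := p) (h := ε)
    (fun i _ => div_nonneg (Real.exp_pos _).le hZ0.le) hsum fun n i _ => by
      rw [re_inner_of_apply_eq_smul e (he.truncation_apply n i)]
      split_ifs
      exacts [le_rfl, he.nonneg i]
  have h2 : ∑ i ∈ s, Real.negMulLog (p i) = t * m + Real.log Z := by
    have : ∀ i, Real.negMulLog (p i) = t * (p i * ε i) + p i * Real.log Z := fun i => by
      have : Real.log (p i) = -t * ε i - Real.log Z := by
        rw [hp, Real.log_div (Real.exp_pos _).ne' hZ0.ne', Real.log_exp]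
      rw [Real.negMulLog, this]; ring
    simp_rw [this]
    rw [Finset.sum_add_distrib, ← Finset.mul_sum, ← Finset.sum_mul, hsum, one_mul]
  rw [h2] at h1
  have h3 := (h1.trans (H.maxEntropy_mono (le_max_left m X))).trans (hF _ (le_max_right m X))
  rw [ENNReal.ofReal_le_ofReal_iff (by positivity)] at h3
  have h4 : √(max m X) ≤ √m + √X := by
    rcases le_total m X with h | h
    · rw [max_eq_right h]; exact le_add_of_nonneg_left (Real.sqrt_nonneg _)
    · rw [max_eq_left h]; exact le_add_of_nonneg_right (Real.sqrt_nonneg _)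
  have h5 : k * √m - t * m ≤ k ^ 2 / (4 * t) := by
    rw [le_div_iff₀ (by positivity)]
    rw [show t * m = t * √m ^ 2 by rw [Real.sq_sqrt hm0]]
    nlinarith [sq_nonneg (2 * t * √m - k)]
  rw [← Real.log_le_iff_le_exp hZ0]
  have h6 := mul_le_mul_of_nonneg_left h4 hk
  linarith

end Hamiltonian

/-! ### The two implications -/

theorem ofReal_exp_rpow (a t : ℝ) :
    ENNReal.ofReal (Real.exp a) ^ t = ENNReal.ofReal (Real.exp (a * t)) := by
  rw [ENNReal.ofReal_rpow_of_pos (Real.exp_pos _), ← Real.exp_mul]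

namespace Hamiltonian

variable {E : Type*} [NormedAddCommGroup E] [InnerProductSpace ℂ E] [CompleteSpace E]

theorem tendsto_maxEntropy_of_tendsto_opTrace (H : Hamiltonian E)
    (h : Tendsto (fun t : ℝ => opTrace (H.expNeg t) ^ t) (𝓝[>] 0) (𝓝 1)) :
    Tendsto (fun x : ℝ => H.maxEntropy x / ENNReal.ofReal (√x)) atTop (𝓝 0) := by
  have hZ : ∀ a : ℝ, 0 < a → ∀ᶠ t in 𝓝[>] (0 : ℝ), 0 < t ∧
      opTrace (H.expNeg t) ≤ ENNReal.ofReal (Real.exp (a / t)) := by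
    intro a ha
    have h1 : (1 : ℝ≥0∞) < ENNReal.ofReal (Real.exp a) := by
      rw [← ENNReal.ofReal_one]
      exact (ENNReal.ofReal_lt_ofReal_iff (Real.exp_pos _)).mpr (Real.one_lt_exp_iff.mpr ha)
    filter_upwards [h.eventually (gt_mem_nhds h1), self_mem_nhdsWithin] with t ht ht0
    refine ⟨ht0, (ENNReal.rpow_le_rpow_iff (z := t) ht0).mp ?_⟩
    rw [ofReal_exp_rpow, div_mul_cancel₀ _ (ne_of_gt ht0)]
    exact ht.le
  obtain ⟨t, ht, hZt⟩ := (hZ 1 one_pos).exists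
  obtain ⟨ι, e, ε, he⟩ := H.exists_isEigenbasis
    (H.finiteDimensional_of_opTrace_expNeg ht (ne_top_of_le_ne_top ENNReal.ofReal_ne_top hZt))
  rw [ENNReal.tendsto_nhds_zero]
  intro r hr
  obtain ⟨s, hs0, hsr⟩ := ENNReal.lt_iff_exists_nnreal_btwn.mp hr
  -- `F_H(x) ≤ t x + δ² / t`, used at the optimal `t = δ / √x`
  set δ : ℝ := s / 2 with hδ
  have hδ0 : 0 < δ := half_pos (by exact_mod_cast hs0)
  have hlim : Tendsto (fun x : ℝ => δ / √x) atTop (𝓝[>] 0) := by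
    refine tendsto_nhdsWithin_iff.mpr ⟨Real.tendsto_sqrt_atTop.const_div_atTop δ, ?_⟩
    filter_upwards [eventually_gt_atTop 0] with x hx
    exact div_pos hδ0 (Real.sqrt_pos.mpr hx)
  filter_upwards [hlim.eventually (hZ (δ ^ 2) (by positivity)), eventually_gt_atTop 0]
    with x hx hx0
  have hsq := Real.sqrt_pos.mpr hx0
  have hF := he.maxEntropy_le hx.1 (Real.one_le_exp (by positivity)) hx0.le hx.2
  have heq : δ / √x * x + Real.log (Real.exp (δ ^ 2 / (δ / √x))) = s * √x := by
    rw [Real.log_exp]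
    have hxx : x = √x * √x := (Real.mul_self_sqrt hx0.le).symm
    have h1 : δ / √x * x = δ * √x := by
      conv_lhs => rw [hxx, Real.sqrt_mul_self hsq.le]
      field_simp
    have h2 : δ ^ 2 / (δ / √x) = δ * √x := by field_simp
    rw [h1, h2, hδ]; ring
  rw [heq, ENNReal.ofReal_mul s.coe_nonneg, ENNReal.ofReal_coe_nnreal] at hF
  exact (ENNReal.div_le_of_le_mul hF).trans hsr.le

theorem tendsto_opTrace_of_tendsto_maxEntropy [Nontrivial E] (H : Hamiltonian E)
    (h : Tendsto (fun x : ℝ => H.maxEntropy x / ENNReal.ofReal (√x)) atTop (𝓝 0)) :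
    Tendsto (fun t : ℝ => opTrace (H.expNeg t) ^ t) (𝓝[>] 0) (𝓝 1) := by
  have hF : ∀ k : ℝ, 0 < k → ∃ X : ℝ, ∀ x, X ≤ x →
      H.maxEntropy x ≤ ENNReal.ofReal (k * √x) := by
    intro k hk
    refine eventually_atTop.mp ?_
    filter_upwards [ENNReal.tendsto_nhds_zero.mp h _ (ENNReal.ofReal_pos.mpr hk),
      eventually_gt_atTop 0] with x hx hx0
    rw [ENNReal.ofReal_mul hk.le]
    exact (ENNReal.div_le_iff (ENNReal.ofReal_pos.mpr (Real.sqrt_pos.mpr hx0)).ne'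
      ENNReal.ofReal_ne_top).mp hx
  obtain ⟨X₁, hX₁⟩ := hF 1 one_pos
  obtain ⟨ι, e, ε, he⟩ := H.exists_isEigenbasis (H.finiteDimensional_of_maxEntropy
    ((eventually_ge_atTop X₁).mono fun x hx =>
      ne_top_of_le_ne_top ENNReal.ofReal_ne_top (hX₁ x hx)).frequently)
  rw [tendsto_order]
  constructor
  · -- one eigenvalue `ε i` already gives `(Tr e^{-tH})^t ≥ e^{-t² ε i}`
    intro a ha
    obtain ⟨i⟩ : Nonempty ι := by
      by_contra hι
      obtain ⟨x, hx⟩ := exists_ne (0 : E)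
      have := not_nonempty_iff.mp hι
      have h1 := tsum_enorm_inner_sq e x
      rw [tsum_empty] at h1
      exact hx (by simpa using h1.symm)
    have hlow : Tendsto (fun t : ℝ => ENNReal.ofReal (Real.exp (-t * ε i * t))) (𝓝[>] 0)
        (𝓝 1) := by
      have hc : Continuous fun t : ℝ => ENNReal.ofReal (Real.exp (-t * ε i * t)) :=
        ENNReal.continuous_ofReal.comp (by fun_prop)
      simpa using (hc.tendsto 0).mono_left nhdsWithin_le_nhds
    filter_upwards [hlow.eventually (lt_mem_nhds ha), self_mem_nhdsWithin] with t ht ht0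
    refine ht.trans_le ?_
    rw [← ofReal_exp_rpow]
    refine ENNReal.rpow_le_rpow ?_ (le_of_lt ht0)
    rw [he.opTrace_expNeg ht0]
    exact ENNReal.le_tsum i
  · -- the exponent is at most `k² / 4 + k` once `√X t < 1`, and `k` is as small as needed
    intro a ha
    have hup : Tendsto (fun k : ℝ => ENNReal.ofReal (Real.exp (k ^ 2 / 4 + k))) (𝓝[>] 0)
        (𝓝 1) := by
      have hc : Continuous fun k : ℝ => ENNReal.ofReal (Real.exp (k ^ 2 / 4 + k)) :=
        ENNReal.continuous_ofReal.comp (by fun_prop)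
      simpa using (hc.tendsto 0).mono_left nhdsWithin_le_nhds
    obtain ⟨k, hka, hk⟩ : ∃ k : ℝ, ENNReal.ofReal (Real.exp (k ^ 2 / 4 + k)) < a ∧ 0 < k :=
      ((hup.eventually (gt_mem_nhds ha)).and self_mem_nhdsWithin).exists
    obtain ⟨X, hX⟩ := hF k hk
    have hsmall : ∀ᶠ t in 𝓝[>] (0 : ℝ), √X * t < 1 := by
      have hc : Continuous fun t : ℝ => √X * t := by fun_prop
      exact (hc.tendsto 0).mono_left nhdsWithin_le_nhds |>.eventually
        (gt_mem_nhds (by simp))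
    filter_upwards [hsmall, self_mem_nhdsWithin] with t ht ht0
    have ht0' : 0 < t := ht0
    refine lt_of_le_of_lt ?_ hka
    refine (ENNReal.rpow_le_rpow (he.opTrace_expNeg_le hk.le ht0' hX) ht0'.le).trans ?_
    rw [ofReal_exp_rpow]
    refine ENNReal.ofReal_le_ofReal (Real.exp_le_exp.mpr ?_)
    have h1 : (k ^ 2 / (4 * t) + k * √X) * t = k ^ 2 / 4 + k * (√X * t) := by field_simp
    rw [h1]
    gcongr
    exact mul_le_of_le_one_right hk.le ht.le

end Hamiltonian

theorem lemma1 {E : Type*} [NormedAddCommGroup E] [InnerProductSpace ℂ E] [CompleteSpace E]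
    [TopologicalSpace.SeparableSpace E] [Nontrivial E] (H : Hamiltonian E) :
    Tendsto (fun t : ℝ => opTrace (H.expNeg t) ^ t) (𝓝[>] 0) (𝓝 1) ↔
      Tendsto (fun x : ℝ => H.maxEntropy x / ENNReal.ofReal (√x)) atTop (𝓝 0) :=
  ⟨H.tendsto_maxEntropy_of_tendsto_opTrace, H.tendsto_opTrace_of_tendsto_maxEntropy⟩
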